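/- Let $w$ be a strictly positive analytic weight on the unit circle $\mathbb T=\{|z|=1\}$, i.e. $w>0$ on $\mathbb T$ and $w$ extends holomorphically to an annulus around $\mathbb T$. Let $$\rho=\inf\{0<s<1:\ 1/w \text{ extends holomorphically to } s<|z|<1/s\},$$ and let $\varphi_n(z)=\kappa_n z^n+\cdots$ with $\kappa_n>0$ ($n\ge 0$) be the polynomials orthonormal with respect to the measure $w(z)\,|dz|$: $$\int_0^{2\pi}\varphi_n(e^{i\theta})\overline{\varphi_m(e^{i\theta})}\,w(e^{i\theta})\,d\theta=\delta_{mn}.$$ Put $$D(w;z)=\exp\Big(\frac1{4\pi}\int_0^{2\pi}\log w(e^{i\theta})\,\frac{e^{i\theta}+z}{e^{i\theta}-z}\,d\theta\Big),\qquad |z|\ne1,$$ and denote by $D_{\rm i}$ and $D_{\rm e}$ its restrictions to $|z|<1$ and $|z|>1$. Both continue analytically across $\mathbb T$. Let $\mathcal S=D_{\rm i}D_{\rm e}$ be the product of these continuations (the scattering function), with Laurent expansion $\mathcal S(z)=\sum_{k\in\mathbb Z}(\mathcal S)_kz^k$ in an annulus around $\mathbb T$; the series $\sum_{k\in\mathbb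 Z}|(\mathcal S)_k|^2$ converges. Finally let $$\tau=\frac1{D_{\rm i}(w;0)}=\exp\Big(-\frac1{4\pi}\int_0^{2\pi}\log w(e^{i\theta})\,d\theta\Big).$$ Then the polynomials $\varphi_n$ exist, and for every fixed $r$ with $\rho<r<1$, as $n\to\infty$, $$\kappa_n^2=\frac{\tau^2}{2\pi}\sum_{k>-n-1}|(\mathcal S)_k|^2+O(r^{4n})$$ and $$\kappa_n^2=\frac{\tau^2}{2\pi}\Big(1-\sum_{k\le -n-1}|(\mathcal S)_k|^2\Big)+O(r^{4n}),$$ where the implied constants depend on $w$ and $r$ only. Consequently $\lim_{n\to\infty}\kappa_n^2=\tau^2/(2\pi)$. -/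

import Mathlib

open Filter Asymptotics Topology Polynomial
open scoped Real

namespace OPUC

/-- The open annulus `s < |z| < 1/s`. -/
def annulus (s : ℝ) : Set ℂ := {z | s < ‖z‖ ∧ ‖z‖ < s⁻¹}

/-- A function `g` on the unit circle extends holomorphically to the annulus `s < |z| < 1/s`. -/
def ExtendsToAnnulus (g : Circle → ℂ) (s : ℝ) : Prop :=
  ∃ f : ℂ → ℂ, DifferentiableOn ℂ f (annulus s) ∧ ∀ z : Circle, f z = g z

/-- `w` is a strictly positive analytic weight on the unit circle: it is positive there and is the
restriction of a function that is holomorphic in an annulus around the circle. -/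
def IsPositiveAnalyticWeight (w : Circle → ℝ) : Prop :=
  (∀ z, 0 < w z) ∧ ∃ s : ℝ, 0 < s ∧ s < 1 ∧ ExtendsToAnnulus (fun z => (w z : ℂ)) s

/-- The constant `ρ`, the infimum of the `s` in `(0, 1)` such that `1 / w` is holomorphic in
`s < |z| < 1/s`. -/
noncomputable def rho (w : Circle → ℝ) : ℝ :=
  sInf {s : ℝ | 0 < s ∧ s < 1 ∧ ExtendsToAnnulus (fun z => 1 / (w z : ℂ)) s}

/-- The formula for the Szegő function `D(w; z)`, meaningful for `|z| ≠ 1`. -/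
noncomputable def szego (w : Circle → ℝ) (z : ℂ) : ℂ :=
  Complex.exp ((1 / (4 * π) : ℂ) * ∫ θ in (0 : ℝ)..(2 * π),
    (Real.log (w (Circle.exp θ)) : ℂ) *
      (((Circle.exp θ : ℂ) + z) / ((Circle.exp θ : ℂ) - z)))

/-- The interior Szegő function `D_i`, extended by continuity to the unit circle. -/
noncomputable def szegoInt (w : Circle → ℝ) : ℂ → ℂ :=
  extendFrom {z : ℂ | ‖z‖ < 1} (szego w)

/-- The exterior Szegő function `D_e`, extended by continuity to the unit circle. -/
noncomputable def szegoExt (w : Circle → ℝ) : ℂ → ℂ :=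
  extendFrom {z : ℂ | 1 < ‖z‖} (szego w)

/-- The constant `τ = exp (-(1/4π) ∫ log w) = 1 / D_i(w; 0)`. -/
noncomputable def tau (w : Circle → ℝ) : ℝ :=
  Real.exp (-(1 / (4 * π)) * ∫ θ in (0 : ℝ)..(2 * π), Real.log (w (Circle.exp θ)))

/-- The scattering function `𝒮 = D_i D_e` on the unit circle. -/
noncomputable def scattering (w : Circle → ℝ) (z : Circle) : ℂ :=
  szegoInt w z * szegoExt w z

/-- The Laurent coefficient `(𝒮)_k`, as a Cauchy integral over the unit circle: with `z = e^{iθ}`,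
`(1/2πi) ∮ 𝒮(z) z^{-k-1} dz = (1/2π) ∫ 𝒮(e^{iθ}) e^{-ikθ} dθ`. -/
noncomputable def scatteringCoeff (w : Circle → ℝ) (k : ℤ) : ℂ :=
  (1 / (2 * π) : ℂ) * ∫ θ in (0 : ℝ)..(2 * π),
    scattering w (Circle.exp θ) * (Circle.exp θ : ℂ) ^ (-k)

/-- `c` is the sequence of Laurent coefficients, in some annulus around the unit circle, of the
product of the analytic continuations of `D_i` and `D_e` across the circle. -/
def IsScatteringLaurent (w : Circle → ℝ) (c : ℤ → ℂ) : Prop :=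
  ∃ s : ℝ, 0 < s ∧ s < 1 ∧ ∃ Di De : ℂ → ℂ,
    DifferentiableOn ℂ Di {z | ‖z‖ < s⁻¹} ∧ (∀ z, ‖z‖ < 1 → Di z = szego w z) ∧
    DifferentiableOn ℂ De {z | s < ‖z‖} ∧ (∀ z, 1 < ‖z‖ → De z = szego w z) ∧
    ∀ z ∈ annulus s, HasSum (fun k : ℤ => c k * z ^ k) (Di z * De z)

/-- `φ` is the sequence of orthonormal polynomials for the measure `w(z) |dz|` on the unit circle:
`φ n` has degree exactly `n`, and a positive leading coefficient. -/
structure IsOrthonormalPolynomials (w : Circle → ℝ) (φ : ℕ → ℂ[X]) : Prop where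
  natDegree_eq : ∀ n, (φ n).natDegree = n
  leadingCoeff_pos : ∀ n, ∃ κ : ℝ, 0 < κ ∧ (φ n).leadingCoeff = κ
  orthonormal : ∀ n m, (∫ θ in (0 : ℝ)..(2 * π),
    (φ n).eval (Circle.exp θ : ℂ) * starRingEnd ℂ ((φ m).eval (Circle.exp θ : ℂ)) *
      (w (Circle.exp θ) : ℂ)) = if n = m then 1 else 0

/-- The leading coefficient `κ_n` of `φ_n`, a real number. -/
noncomputable def kappa (φ : ℕ → ℂ[X]) (n : ℕ) : ℝ := (φ n).leadingCoeff.re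

end OPUC

/-! Write `D` for the interior Szegő function on the circle and `E = 1 / D`. Since the exterior
Szegő function is `1 / conj D` there, the scattering function is `S = D * star E`, which is
unimodular. Reversing polynomials, `Q = z ^ n * conj p`, turns the extremal property of the leading
coefficient into the statement that `2π |D(0)|² κ_n²` is the maximum of `|M(DQ)|² / M(|DQ|²)` over
polynomials `Q` of degree at most `n`, where `M` is the mean over the circle and `M(DQ) = D(0) Q(0)`
(`kappa_sq_le`, `le_kappa_sq`).

Let `P` be the part of `S` with frequencies above `-n - 1`. Replacing `1 = |S|²` by `conj S * P` in
`M(DQ)` costs only `M(conj D * Q * (S - P))`, whose integrand has negative frequencies only. Hence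
`M(DQ)` is the inner product of `DQ` with `S * conj P`, and Cauchy–Schwarz bounds the maximum by
`M(|P|²)` (`norm_mean_sq_le`).

Equality would require `Q = conj E * conj P`. This has no frequency above `n`, but it is not a
polynomial; the trial polynomial is its truncation to frequencies `0, ..., n`. The discarded part is
the negative-frequency part of `conj ((S - P) * E)`. There `S - P` contributes a factor `r ^ n`, and
only coefficients of `E` of index at least `n + 2` enter, which contributes another. The error is
thus `O(r ^ (2n))` uniformly (`norm_trialError_le`), and it enters the extremal value quadratically,
which gives `O(r ^ (4n))` (`extremal_isBigO`).

The decay rate of the coefficients of `E` comes from `E = conj D / w` on the circle: `conj D`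
continues to the whole exterior, so the outer radius of holomorphy is governed by `1 / w`, that is,
by `ρ` (`exists_outerPair`). Parseval for the unimodular `S` makes the two forms of the asymptotics
equivalent. -/

namespace OPUC

/-! ### Fourier analysis of continuous functions on the unit circle -/

/-- The function `z ↦ z ^ k` on the unit circle. -/
noncomputable def zpowMap (k : ℤ) : C(Circle, ℂ) :=
  ⟨fun z => ((z ^ k : Circle) : ℂ), continuous_subtype_val.comp (continuous_zpow k)⟩

@[simp] lemma zpowMap_apply (k : ℤ) (z : Circle) : zpowMap k z = (z : ℂ) ^ k := by
  simp [zpowMap]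

lemma zpowMap_add (j k : ℤ) : zpowMap (j + k) = zpowMap j * zpowMap k := by
  ext z
  simp [zpow_add₀ z.coe_ne_zero]

lemma zpowMap_zero : zpowMap 0 = 1 := by
  ext z
  simp

lemma star_zpowMap (k : ℤ) : star (zpowMap k) = zpowMap (-k) := by
  ext z
  simp [← Circle.coe_inv_eq_conj]

lemma norm_zpowMap (k : ℤ) : ‖zpowMap k‖ = 1 := by
  refine le_antisymm ((ContinuousMap.norm_le _ zero_le_one).2 fun z => by
    rw [zpowMap_apply, norm_zpow, Circle.norm_coe, one_zpow]) ?_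
  simpa using (zpowMap k).norm_coe_le_norm 1

lemma intervalIntegrable_comp_exp (f : C(Circle, ℂ)) (a b : ℝ) :
    IntervalIntegrable (fun θ => f (Circle.exp θ)) MeasureTheory.volume a b :=
  (f.continuous.comp Circle.exp.continuous).intervalIntegrable _ _

/-- The mean of a continuous function over the unit circle. -/
noncomputable def mean : C(Circle, ℂ) →L[ℂ] ℂ :=
  LinearMap.mkContinuous
    { toFun := fun f => (1 / (2 * π) : ℂ) * ∫ θ in (0 : ℝ)..(2 * π), f (Circle.exp θ)
      map_add' := fun f g => by
        simp only [ContinuousMap.add_apply]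
        rw [intervalIntegral.integral_add (intervalIntegrable_comp_exp f _ _)
          (intervalIntegrable_comp_exp g _ _), mul_add]
      map_smul' := fun c f => by
        simp only [ContinuousMap.smul_apply, smul_eq_mul, RingHom.id_apply]
        rw [intervalIntegral.integral_const_mul]
        ring } 1 fun f => by
    have h : ‖∫ θ in (0 : ℝ)..(2 * π), f (Circle.exp θ)‖ ≤ ‖f‖ * |2 * π - 0| :=
      intervalIntegral.norm_integral_le_of_norm_le_const fun θ _ => f.norm_coe_le_norm _
    rw [sub_zero, abs_of_pos Real.two_pi_pos] at h
    simp only [LinearMap.coe_mk, AddHom.coe_mk, norm_mul, one_mul]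
    have h2 : ‖(1 / (2 * π) : ℂ)‖ = 1 / (2 * π) := by
      simp [abs_of_pos Real.pi_pos]
    rw [h2, div_mul_eq_mul_div, one_mul, div_le_iff₀ Real.two_pi_pos]
    exact h

lemma mean_apply (f : C(Circle, ℂ)) :
    mean f = (1 / (2 * π) : ℂ) * ∫ θ in (0 : ℝ)..(2 * π), f (Circle.exp θ) := rfl

lemma mean_zpowMap (k : ℤ) : mean (zpowMap k) = if k = 0 then 1 else 0 := by
  rw [mean_apply]
  have hpi : (π : ℂ) ≠ 0 := by exact_mod_cast Real.pi_ne_zero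
  split_ifs with hk
  · subst hk
    simp only [zpowMap_zero, ContinuousMap.one_apply, intervalIntegral.integral_const, sub_zero,
      Complex.real_smul, mul_one]
    push_cast
    field_simp
  · have h : ∀ θ : ℝ, zpowMap k (Circle.exp θ) = Complex.exp ((k * Complex.I) * θ) := fun θ => by
      rw [zpowMap_apply, Circle.coe_exp, ← Complex.exp_int_mul]
      ring_nf
    simp only [h]
    have hc : (k * Complex.I : ℂ) ≠ 0 := mul_ne_zero (by exact_mod_cast hk) Complex.I_ne_zero
    rw [integral_exp_mul_complex hc]
    have : Complex.exp (k * Complex.I * ((2 * π : ℝ) : ℂ)) = 1 := by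
      rw [← Complex.exp_int_mul_two_pi_mul_I k]
      push_cast
      ring_nf
    rw [this]
    simp

lemma mean_star (f : C(Circle, ℂ)) : mean (star f) = starRingEnd ℂ (mean f) := by
  have h : ∫ θ in (0 : ℝ)..(2 * π), (star f) (Circle.exp θ)
      = starRingEnd ℂ (∫ θ in (0 : ℝ)..(2 * π), f (Circle.exp θ)) := by
    rw [intervalIntegral.integral_of_le Real.two_pi_pos.le,
      intervalIntegral.integral_of_le Real.two_pi_pos.le, ← integral_conj]
    rfl
  rw [mean_apply, mean_apply, h, map_mul]
  congr 1
  rw [← Complex.ofReal_ofNat, ← Complex.ofReal_mul, ← Complex.ofReal_one, ← Complex.ofReal_div,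
    Complex.conj_ofReal]

/-- The mean of `|f|²` over the unit circle. -/
noncomputable def meanSq (f : C(Circle, ℂ)) : ℝ :=
  1 / (2 * π) * ∫ θ in (0 : ℝ)..(2 * π), ‖f (Circle.exp θ)‖ ^ 2

lemma mean_mul_star_self (f : C(Circle, ℂ)) : mean (f * star f) = (meanSq f : ℂ) := by
  rw [mean_apply, meanSq]
  push_cast
  rw [← intervalIntegral.integral_ofReal]
  congr 2
  ext θ
  simp [Complex.mul_conj, Complex.normSq_eq_norm_sq]

lemma meanSq_nonneg (f : C(Circle, ℂ)) : 0 ≤ meanSq f :=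
  mul_nonneg (by positivity)
    (intervalIntegral.integral_nonneg Real.two_pi_pos.le fun _ _ => by positivity)

lemma meanSq_le_norm_sq (f : C(Circle, ℂ)) : meanSq f ≤ ‖f‖ ^ 2 := by
  have h : ‖(meanSq f : ℂ)‖ ≤ ‖f * star f‖ := by
    rw [← mean_mul_star_self]
    exact (mean.le_of_opNorm_le (LinearMap.mkContinuous_norm_le _ zero_le_one _) _).trans_eq
      (one_mul _)
  rw [CStarRing.norm_self_mul_star, ← sq, Complex.norm_real] at h
  exact (le_abs_self _).trans h

lemma meanSq_sub (f g : C(Circle, ℂ)) :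
    meanSq (f - g) = meanSq f - 2 * (mean (f * star g)).re + meanSq g := by
  have h : (meanSq (f - g) : ℂ)
      = meanSq f - (mean (f * star g) + starRingEnd ℂ (mean (f * star g))) + meanSq g := by
    rw [← mean_mul_star_self, ← mean_mul_star_self, ← mean_mul_star_self, ← mean_star,
      ← map_add, ← map_sub, ← map_add]
    congr 1
    simp only [star_sub, star_mul, star_star]
    ring
  rw [Complex.add_conj] at h
  exact_mod_cast h

lemma meanSq_smul (c : ℂ) (f : C(Circle, ℂ)) : meanSq (c • f) = ‖c‖ ^ 2 * meanSq f := by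
  simp only [meanSq, ContinuousMap.smul_apply, smul_eq_mul, norm_mul, mul_pow,
    intervalIntegral.integral_const_mul]
  ring

lemma norm_mean_mul_star_sq_le (f g : C(Circle, ℂ)) :
    ‖mean (f * star g)‖ ^ 2 ≤ meanSq f * meanSq g := by
  set m := mean (f * star g) with hm
  -- Expand the mean square of `f - t m g`; the factor `m` makes the cross term real.
  have key : ∀ t : ℝ, 0 ≤ meanSq f - 2 * t * ‖m‖ ^ 2 + t ^ 2 * ‖m‖ ^ 2 * meanSq g := fun t => by
    have h := meanSq_nonneg (f - ((t : ℂ) * m) • g)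
    rw [meanSq_sub, meanSq_smul, norm_mul, mul_pow, star_smul, mul_smul_comm, map_smul, ← hm,
      smul_eq_mul, Complex.norm_real, Real.norm_eq_abs, sq_abs] at h
    have h2 : (star ((t : ℂ) * m) * m).re = t * ‖m‖ ^ 2 := by
      rw [← starRingEnd_apply, map_mul, Complex.conj_ofReal, mul_assoc, Complex.conj_mul',
        ← Complex.ofReal_pow, ← Complex.ofReal_mul, Complex.ofReal_re]
    rw [h2] at h
    linarith
  rcases (norm_nonneg m).eq_or_lt with h0 | h0
  · rw [← h0]
    simpa using mul_nonneg (meanSq_nonneg f) (meanSq_nonneg g)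
  rcases (meanSq_nonneg g).eq_or_lt with hg | hg
  · exfalso
    -- With no quadratic term, this `t` would make the bound equal to `-meanSq f - 2`.
    have h := key ((meanSq f + 1) / ‖m‖ ^ 2)
    rw [← hg, mul_zero, add_zero, mul_assoc, div_mul_cancel₀ _ (by positivity)] at h
    linarith [meanSq_nonneg f]
  -- The minimiser of the quadratic in `t`.
  · have h := key (meanSq g)⁻¹
    have h2 : meanSq f - 2 * (meanSq g)⁻¹ * ‖m‖ ^ 2 + (meanSq g)⁻¹ ^ 2 * ‖m‖ ^ 2 * meanSq g
        = (meanSq f * meanSq g - ‖m‖ ^ 2) / meanSq g := by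
      field_simp
      ring
    rw [h2] at h
    have := mul_nonneg h hg.le
    rw [div_mul_cancel₀ _ hg.ne'] at this
    linarith

/-- The Fourier coefficients of a continuous function on the unit circle. -/
noncomputable def coef (f : C(Circle, ℂ)) (k : ℤ) : ℂ := mean (f * zpowMap (-k))

lemma coef_zero_index (f : C(Circle, ℂ)) : coef f 0 = mean f := by
  simp [coef, zpowMap_zero]

lemma coef_add (f g : C(Circle, ℂ)) (k : ℤ) : coef (f + g) k = coef f k + coef g k := by
  simp [coef, add_mul]

lemma coef_sub (f g : C(Circle, ℂ)) (k : ℤ) : coef (f - g) k = coef f k - coef g k := by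
  simp [coef, sub_mul]

lemma coef_zpowMap (j k : ℤ) : coef (zpowMap j) k = if j = k then 1 else 0 := by
  rw [coef, ← zpowMap_add, mean_zpowMap]
  simp [add_neg_eq_zero]

lemma coef_star (f : C(Circle, ℂ)) (k : ℤ) : coef (star f) k = starRingEnd ℂ (coef f (-k)) := by
  rw [coef, coef, ← mean_star, star_mul', star_zpowMap]
  simp

lemma coef_mul_zpowMap (f : C(Circle, ℂ)) (j k : ℤ) : coef (f * zpowMap j) k = coef f (k - j) := by
  rw [coef, coef, mul_assoc, ← zpowMap_add]
  congr 3
  ring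

lemma mean_mul_zpowMap (f : C(Circle, ℂ)) (k : ℤ) : mean (f * zpowMap k) = coef f (-k) := by
  rw [coef, neg_neg]

/-- Absolute summability gives convergence in the sup norm; the limit is identified pointwise after
transport to `AddCircle (2 * π)`. -/
lemma hasSum_coef {f : C(Circle, ℂ)} (hf : Summable fun k => ‖coef f k‖) :
    HasSum (fun k => coef f k • zpowMap k) f := by
  have : Fact (0 < 2 * π) := ⟨Real.two_pi_pos⟩
  have hs : Summable fun k => coef f k • zpowMap k :=
    Summable.of_norm (by simpa only [norm_smul, norm_zpowMap, mul_one] using hf)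
  let F : C(AddCircle (2 * π), ℂ) :=
    ⟨fun x => f x.toCircle, f.continuous.comp AddCircle.continuous_toCircle⟩
  have hexp : ∀ x : ℝ, AddCircle.toCircle (x : AddCircle (2 * π)) = Circle.exp x := fun x => by
    rw [AddCircle.toCircle_apply_mk, div_self Real.two_pi_pos.ne', one_mul]
  have hF : ∀ k, fourierCoeff F k = coef f k := fun k => by
    rw [fourierCoeff_eq_intervalIntegral _ _ 0, coef, mean_apply, zero_add, Complex.real_smul]
    push_cast
    congr 2
    ext x
    change fourier (-k) (x : AddCircle (2 * π)) • F x = f (Circle.exp x) * zpowMap (-k) (Circle.exp x)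
    simp only [fourier_apply, F, ContinuousMap.coe_mk, AddCircle.toCircle_zsmul, hexp,
      zpowMap_apply, smul_eq_mul, Circle.coe_zpow, mul_comm]
  have hsum : Summable (fourierCoeff F) := by
    simpa only [funext hF] using hf.of_norm
  have hf' : f = ∑' k, coef f k • zpowMap k := by
    ext z
    obtain ⟨θ, rfl⟩ := Circle.exp_surjective z
    have h1 := has_pointwise_sum_fourier_series_of_summable hsum (θ : AddCircle (2 * π))
    have h2 := (ContinuousMap.evalCLM ℂ (Circle.exp θ)).hasSum hs.hasSum
    have h3 : (fun k => fourierCoeff F k • fourier k (θ : AddCircle (2 * π)))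
        = fun k => ContinuousMap.evalCLM ℂ (Circle.exp θ) (coef f k • zpowMap k) := by
      ext k
      simp [hF, fourier_apply, AddCircle.toCircle_zsmul, hexp, ContinuousMap.evalCLM]
    rw [h3] at h1
    have := h1.unique h2
    rwa [show F (θ : AddCircle (2 * π)) = f (Circle.exp θ) by simp [F, hexp]] at this
  have h := hs.hasSum
  rwa [← hf'] at h

lemma hasSum_mean_mul {b : ℤ → ℂ} {f : C(Circle, ℂ)} (hf : HasSum (fun k => b k • zpowMap k) f)
    (g : C(Circle, ℂ)) : HasSum (fun k => b k * coef g (-k)) (mean (f * g)) := by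
  refine (mean.hasSum (hf.mul_right g)).congr_fun fun k => ?_
  rw [smul_mul_assoc, map_smul, mul_comm (zpowMap k), mean_mul_zpowMap, smul_eq_mul]

lemma hasSum_coef_mul {b : ℤ → ℂ} {f : C(Circle, ℂ)} (hf : HasSum (fun k => b k • zpowMap k) f)
    (g : C(Circle, ℂ)) (k : ℤ) : HasSum (fun j => b j * coef g (k - j)) (coef (f * g) k) := by
  have h := hasSum_mean_mul hf (g * zpowMap (-k))
  rw [← mul_assoc] at h
  refine h.congr_fun fun j => ?_
  rw [coef_mul_zpowMap, neg_sub_neg]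

lemma coef_eq_of_hasSum {b : ℤ → ℂ} {f : C(Circle, ℂ)}
    (hf : HasSum (fun k => b k • zpowMap k) f) (k : ℤ) : coef f k = b k := by
  have h := hasSum_coef_mul hf 1 k
  rw [mul_one] at h
  refine h.unique ?_
  convert hasSum_ite_eq k (b k) using 2 with j
  rw [← zpowMap_zero, coef_zpowMap]
  by_cases hj : j = k
  · simp [hj]
  · have : (0 : ℤ) ≠ k - j := fun h => hj (by omega)
    simp [hj, this]

lemma hasSum_of_summable_norm {b : ℤ → ℂ} (hb : Summable fun k => ‖b k‖) :
    HasSum (fun k => b k • zpowMap k) (∑' k, b k • zpowMap k) :=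
  (Summable.of_norm (by simpa only [norm_smul, norm_zpowMap, mul_one] using hb)).hasSum

lemma norm_le_tsum_coef {f : C(Circle, ℂ)} (hf : Summable fun k => ‖coef f k‖) :
    ‖f‖ ≤ ∑' k, ‖coef f k‖ := by
  refine (hasSum_coef hf).norm_le_of_bounded hf.hasSum fun k => ?_
  rw [norm_smul, norm_zpowMap, mul_one]

/-- Parseval's identity. -/
lemma hasSum_norm_coef_sq {f : C(Circle, ℂ)} (hf : Summable fun k => ‖coef f k‖) :
    HasSum (fun k => ‖coef f k‖ ^ 2) (meanSq f) := by
  have h := hasSum_mean_mul (hasSum_coef hf) (star f)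
  rw [mean_mul_star_self] at h
  rw [← Complex.hasSum_ofReal]
  refine h.congr_fun fun k => ?_
  rw [coef_star, neg_neg, Complex.mul_conj']
  push_cast
  rfl

/-- In the convolution for index `k`, each term has `j > c` or `k - j > d`. -/
lemma coef_mul_eq_zero_of_lt {f g : C(Circle, ℂ)} {c d : ℤ} (hf : Summable fun k => ‖coef f k‖)
    (hfc : ∀ k, c < k → coef f k = 0) (hgd : ∀ k, d < k → coef g k = 0) (k : ℤ) (hk : c + d < k) :
    coef (f * g) k = 0 := by
  refine (hasSum_coef_mul (hasSum_coef hf) g k).unique ?_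
  convert hasSum_zero using 2 with j
  by_cases hj : c < j
  · rw [hfc j hj, zero_mul]
  · rw [hgd _ (by omega), mul_zero]

/-! ### The extremal problem -/

/-- Serves both the low part of the scattering function and, with `n = 0`, the purely negative
frequencies of the trial error. -/
lemma summable_and_tsum_norm_le_of_geometric {b : ℤ → ℂ} {n : ℤ} {K r : ℝ} (hr0 : 0 ≤ r)
    (hr1 : r < 1) (hb0 : ∀ k, -n - 1 < k → b k = 0)
    (hb : ∀ i : ℕ, ‖b (-n - 1 - i)‖ ≤ K * r ^ i) :
    (Summable fun k => ‖b k‖) ∧ ∑' k, ‖b k‖ ≤ K * (1 - r)⁻¹ := by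
  have hinj : Function.Injective fun i : ℕ => -n - 1 - (i : ℤ) := fun i j h => by
    simpa using h
  have hsupp : ∀ k, k ∉ Set.range (fun i : ℕ => -n - 1 - (i : ℤ)) → ‖b k‖ = 0 := fun k hk => by
    rw [hb0 k, norm_zero]
    by_contra! h
    exact hk ⟨(-n - 1 - k).toNat, by simp only; omega⟩
  have hg := (hasSum_geometric_of_lt_one hr0 hr1).mul_left K
  have hs : Summable fun i : ℕ => ‖b (-n - 1 - i)‖ :=
    Summable.of_nonneg_of_le (fun _ => norm_nonneg _) hb hg.summable
  refine ⟨(hinj.summable_iff hsupp).1 hs, ?_⟩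
  rw [← hinj.tsum_eq (f := fun k => ‖b k‖) fun k hk => by
    by_contra h; exact hk (hsupp k h)]
  exact (hs.tsum_le_tsum hb hg.summable).trans_eq hg.tsum_eq

/-- The part of the Laurent series of `f` with indices at most `-n - 1`. -/
noncomputable def lowPart (f : C(Circle, ℂ)) (n : ℤ) : C(Circle, ℂ) :=
  ∑' k, (if k ≤ -n - 1 then coef f k else 0) • zpowMap k

lemma hasSum_lowPart {f : C(Circle, ℂ)} (hf : Summable fun k => ‖coef f k‖) (n : ℤ) :
    HasSum (fun k => (if k ≤ -n - 1 then coef f k else 0) • zpowMap k) (lowPart f n) := by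
  refine hasSum_of_summable_norm (Summable.of_nonneg_of_le (fun _ => norm_nonneg _) (fun k => ?_) hf)
  split_ifs <;> simp

lemma coef_lowPart {f : C(Circle, ℂ)} (hf : Summable fun k => ‖coef f k‖) (n k : ℤ) :
    coef (lowPart f n) k = if k ≤ -n - 1 then coef f k else 0 :=
  coef_eq_of_hasSum (hasSum_lowPart hf n) k

lemma summable_coef_lowPart {f : C(Circle, ℂ)} (hf : Summable fun k => ‖coef f k‖) (n : ℤ) :
    Summable fun k => ‖coef (lowPart f n) k‖ := by
  refine Summable.of_nonneg_of_le (fun _ => norm_nonneg _) (fun k => ?_) hf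
  rw [coef_lowPart hf]
  split_ifs <;> simp

lemma summable_coef_star {f : C(Circle, ℂ)} (hf : Summable fun k => ‖coef f k‖) :
    Summable fun k => ‖coef (star f) k‖ := by
  simpa [coef_star, Function.comp_def] using hf.comp_injective neg_injective

lemma summable_coef_sub {f g : C(Circle, ℂ)} (hf : Summable fun k => ‖coef f k‖)
    (hg : Summable fun k => ‖coef g k‖) : Summable fun k => ‖coef (f - g) k‖ :=
  Summable.of_nonneg_of_le (fun _ => norm_nonneg _)
    (fun k => by rw [coef_sub]; exact norm_sub_le _ _) (hf.add hg)

/-- An outer function `D` on the circle with absolutely summable Fourier series, together with its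
inverse `E`, such that the Fourier series of `D * star E` is absolutely summable. -/
structure OuterPair (D E : C(Circle, ℂ)) : Prop where
  mul_eq_one : D * E = 1
  summable_left : Summable fun k => ‖coef D k‖
  summable_right : Summable fun k => ‖coef E k‖
  coef_left : ∀ k < 0, coef D k = 0
  coef_right : ∀ k < 0, coef E k = 0
  summable_scattering : Summable fun k => ‖coef (D * star E) k‖

namespace OuterPair

variable {D E : C(Circle, ℂ)}

lemma star_mul_star (h : OuterPair D E) : star D * star E = 1 := by
  rw [← star_mul', h.mul_eq_one, star_one]

lemma scattering_mul_star (h : OuterPair D E) : (D * star E) * star (D * star E) = 1 := by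
  have h1 := h.mul_eq_one
  have h2 := h.star_mul_star
  rw [star_mul', star_star]
  calc D * star E * (star D * E) = (D * E) * (star D * star E) := by ring
    _ = 1 := by rw [h1, h2, one_mul]

/-- The part of the Laurent series of the scattering function with indices greater than `-n - 1`. -/
noncomputable def highPart (D E : C(Circle, ℂ)) (n : ℤ) : C(Circle, ℂ) :=
  D * star E - lowPart (D * star E) n

lemma coef_highPart (h : OuterPair D E) (n k : ℤ) :
    coef (highPart D E n) k = if k ≤ -n - 1 then 0 else coef (D * star E) k := by
  rw [highPart, coef_sub, coef_lowPart h.summable_scattering]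
  split_ifs <;> simp

lemma summable_coef_highPart (h : OuterPair D E) (n : ℤ) :
    Summable fun k => ‖coef (highPart D E n) k‖ :=
  summable_coef_sub h.summable_scattering (summable_coef_lowPart h.summable_scattering n)

lemma hasSum_meanSq_highPart (h : OuterPair D E) (n : ℤ) :
    HasSum (fun k => if k ≤ -n - 1 then 0 else ‖coef (D * star E) k‖ ^ 2)
      (meanSq (highPart D E n)) := by
  refine (hasSum_norm_coef_sq (h.summable_coef_highPart n)).congr_fun fun k => ?_
  rw [h.coef_highPart]
  split_ifs <;> simp

lemma hasSum_meanSq_lowPart (h : OuterPair D E) (n : ℤ) :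
    HasSum (fun k => if k ≤ -n - 1 then ‖coef (D * star E) k‖ ^ 2 else 0)
      (meanSq (lowPart (D * star E) n)) := by
  refine (hasSum_norm_coef_sq (summable_coef_lowPart h.summable_scattering n)).congr_fun
    fun k => ?_
  rw [coef_lowPart h.summable_scattering]
  split_ifs <;> simp

lemma hasSum_norm_coef_sq_scattering (h : OuterPair D E) :
    HasSum (fun k => ‖coef (D * star E) k‖ ^ 2) 1 := by
  have h1 := hasSum_norm_coef_sq h.summable_scattering
  have h2 := mean_mul_star_self (D * star E)
  rw [h.scattering_mul_star, ← zpowMap_zero, mean_zpowMap, if_pos rfl] at h2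
  rwa [show meanSq (D * star E) = 1 by exact_mod_cast h2.symm] at h1

lemma meanSq_highPart (h : OuterPair D E) (n : ℤ) :
    meanSq (highPart D E n) = 1 - meanSq (lowPart (D * star E) n) := by
  have h1 := ((h.hasSum_meanSq_highPart n).add (h.hasSum_meanSq_lowPart n)).unique
    (h.hasSum_norm_coef_sq_scattering.congr_fun fun k => by split_ifs <;> simp)
  linarith

/-! ### Upper bound in the extremal problem -/

lemma meanSq_scattering_mul (h : OuterPair D E) (f : C(Circle, ℂ)) :
    meanSq (D * star E * star f) = meanSq f := by
  have h1 : (meanSq (D * star E * star f) : ℂ) = meanSq f := by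
    rw [← mean_mul_star_self, ← mean_mul_star_self, star_mul' _ (star f), star_star,
      mul_mul_mul_comm, h.scattering_mul_star, one_mul, mul_comm]
  exact_mod_cast h1

/-- The function `S * star P`, with `P` the high part, represents the functional `Q ↦ M(DQ)` on
these `Q`. By unimodularity the discrepancy is `M(low * star D * Q)`, with frequencies at most `(-n
- 1) + 0 + n < 0`. -/
lemma mean_mul_star_highPart (h : OuterPair D E) {n : ℤ} {Q : C(Circle, ℂ)}
    (hQ : ∀ k, n < k → coef Q k = 0) :
    mean (D * Q * star (D * star E * star (highPart D E n))) = mean (D * Q) := by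
  have h1 : D * Q * star (D * star E * star (highPart D E n))
      = D * Q - lowPart (D * star E) n * (star D * Q) := by
    have e1 := h.mul_eq_one
    have e2 := h.scattering_mul_star
    simp only [highPart, star_mul', star_star] at e2 ⊢
    calc _ = D * Q * ((D * star E) * (star D * E))
          - lowPart (D * star E) n * (star D * Q) * (D * E) := by ring
      _ = _ := by rw [e1, e2, mul_one, mul_one]
  rw [h1, map_sub, ← coef_zero_index (lowPart (D * star E) n * (star D * Q)), sub_eq_self]
  refine coef_mul_eq_zero_of_lt (c := -n - 1) (d := 0 + n)
    (summable_coef_lowPart h.summable_scattering n) (fun k hk => ?_)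
    (coef_mul_eq_zero_of_lt (summable_coef_star h.summable_left) (fun k hk => ?_) hQ) 0 (by omega)
  · rw [coef_lowPart h.summable_scattering, if_neg (by omega)]
  · rw [coef_star, h.coef_left _ (by omega), map_zero]

lemma norm_mean_sq_le (h : OuterPair D E) {n : ℤ} {Q : C(Circle, ℂ)}
    (hQ : ∀ k, n < k → coef Q k = 0) :
    ‖mean (D * Q)‖ ^ 2 ≤ meanSq (D * Q) * meanSq (highPart D E n) := by
  have h1 := norm_mean_mul_star_sq_le (D * Q) (D * star E * star (highPart D E n))
  rwa [h.mean_mul_star_highPart hQ, h.meanSq_scattering_mul] at h1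

/-- Both factors have nonnegative frequencies only, so just the product of the constant terms
survives. -/
lemma mean_mul (h : OuterPair D E) {Q : C(Circle, ℂ)} (hQ : ∀ k < 0, coef Q k = 0) :
    mean (D * Q) = mean D * mean Q := by
  have h1 := hasSum_mean_mul (hasSum_coef h.summable_left) Q
  refine h1.unique ?_
  convert hasSum_ite_eq (0 : ℤ) (mean D * mean Q) using 2 with k
  rcases lt_trichotomy k 0 with hk | hk | hk
  · rw [if_neg hk.ne, h.coef_left k hk, zero_mul]
  · subst hk
    rw [if_pos rfl, neg_zero, coef_zero_index, coef_zero_index]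
  · rw [if_neg hk.ne', hQ _ (by omega), mul_zero]

/-! ### The trial polynomial and its error -/

/-- The trial polynomial for the extremal problem. -/
noncomputable def trial (D E : C(Circle, ℂ)) (n : ℕ) : C(Circle, ℂ) :=
  ∑ k ∈ Finset.range (n + 1), coef (star E * star (highPart D E n)) k • zpowMap k

lemma coef_sum_zpowMap (c : ℕ → ℂ) (n : ℕ) (k : ℤ) :
    coef (∑ j ∈ Finset.range (n + 1), c j • zpowMap j) k
      = if 0 ≤ k ∧ k ≤ n then c k.toNat else 0 := by
  have h1 : coef (∑ j ∈ Finset.range (n + 1), c j • zpowMap j) k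
      = ∑ j ∈ Finset.range (n + 1), c j * if (j : ℤ) = k then 1 else 0 := by
    simp only [← coef_zpowMap]
    simp [coef, Finset.sum_mul]
  rw [h1]
  split_ifs with hk
  · rw [Finset.sum_eq_single k.toNat]
    · rw [if_pos (by omega), mul_one]
    · intro j _ hj
      rw [if_neg (by omega), mul_zero]
    · intro hj
      exact absurd (Finset.mem_range.2 (by omega)) hj
  · refine Finset.sum_eq_zero fun j hj => ?_
    rw [Finset.mem_range] at hj
    rw [if_neg (by omega), mul_zero]

lemma coef_trial (D E : C(Circle, ℂ)) (n : ℕ) (k : ℤ) :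
    coef (trial D E n) k
      = if 0 ≤ k ∧ k ≤ n then coef (star E * star (highPart D E n)) k else 0 := by
  rw [trial, coef_sum_zpowMap (fun k : ℕ => coef (star E * star (highPart D E n)) k)]
  split_ifs with hk
  · rw [Int.toNat_of_nonneg hk.1]
  · rfl

/-- The error of the trial polynomial. -/
noncomputable def trialError (D E : C(Circle, ℂ)) (n : ℕ) : C(Circle, ℂ) :=
  trial D E n - star E * star (highPart D E n)

/-- Truncation is exact on `0, ..., n`, and above `n` there is nothing to truncate: `star E` has
frequencies at most `0` and `star P` at most `n`. -/
lemma coef_trialError_of_nonneg (h : OuterPair D E) (n : ℕ) {k : ℤ} (hk : 0 ≤ k) :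
    coef (trialError D E n) k = 0 := by
  rw [trialError, coef_sub, coef_trial]
  split_ifs with hk'
  · exact sub_self _
  · rw [coef_mul_eq_zero_of_lt (c := 0) (d := n) (summable_coef_star h.summable_right), sub_zero]
    · intro j hj
      rw [coef_star, h.coef_right _ (by omega), map_zero]
    · intro j hj
      rw [coef_star, h.coef_highPart, if_pos (by omega), map_zero]
    · omega

/-- Since `star E * star S = E` has no negative frequencies, only the low part of `S` contributes.
-/
lemma coef_trialError_of_neg (h : OuterPair D E) (n : ℕ) {k : ℤ} (hk : k < 0) :
    coef (trialError D E n) k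
      = starRingEnd ℂ (coef (lowPart (D * star E) n * E) (-k)) := by
  have e2 := h.star_mul_star
  have h1 : trialError D E n
      = trial D E n - E + star (lowPart (D * star E) n * E) := by
    simp only [trialError, highPart, star_mul', star_sub, star_star]
    calc _ = trial D E n - E * (star D * star E) + star (lowPart (D * star E) n) * star E := by ring
      _ = _ := by rw [e2, mul_one]
  rw [h1, coef_add, coef_sub, coef_trial, if_neg (by omega), h.coef_right k hk, coef_star]
  simp

lemma mul_trial (D E : C(Circle, ℂ)) (n : ℕ) :
    D * trial D E n - D * star E * star (highPart D E n) = D * trialError D E n := by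
  rw [trialError]
  ring

/-- The square of the distance from `D * trial` to the representing function `S * star P`, expanded;
that distance is the norm of `D * trialError`. -/
lemma meanSq_mul_trial (h : OuterPair D E) (n : ℕ) :
    meanSq (D * trial D E n) = meanSq (D * trialError D E n)
      + 2 * (mean (D * trial D E n)).re - meanSq (highPart D E n) := by
  have h1 := meanSq_sub (D * trial D E n) (D * star E * star (highPart D E n))
  rw [mul_trial, h.meanSq_scattering_mul, h.mean_mul_star_highPart] at h1
  · linarith
  · intro k hk
    rw [coef_trial, if_neg (by omega)]

lemma norm_mean_mul_trial_sub_sq_le (h : OuterPair D E) (n : ℕ) :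
    ‖mean (D * trial D E n) - meanSq (highPart D E n)‖ ^ 2
      ≤ meanSq (D * trialError D E n) * meanSq (highPart D E n) := by
  have h1 := norm_mean_mul_star_sq_le (D * trialError D E n) (D * star E * star (highPart D E n))
  rw [← mul_trial, sub_mul, map_sub, mean_mul_star_self, mul_trial, h.meanSq_scattering_mul,
    h.mean_mul_star_highPart] at h1
  · exact h1
  · intro k hk
    rw [coef_trial, if_neg (by omega)]

/-! ### Decay estimates and the extremal value -/

lemma norm_coef_scattering_le (h : OuterPair D E) {C r : ℝ} (hr0 : 0 < r) (hr1 : r < 1)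
    (hC : ∀ k : ℤ, ‖coef E k‖ ≤ C * r ^ k) (k : ℤ) :
    ‖coef (D * star E) (-k)‖ ≤ (∑' j, ‖coef D j‖) * C * r ^ k := by
  have hC0 : 0 ≤ C := by simpa using (norm_nonneg _).trans (hC 0)
  have h1 := hasSum_coef_mul (hasSum_coef h.summable_left) (star E) (-k)
  have h2 := h.summable_left.hasSum.mul_right (C * r ^ k)
  rw [mul_assoc]
  refine h1.norm_le_of_bounded h2 fun j => ?_
  rw [norm_mul]
  rcases lt_or_ge j 0 with hj | hj
  · simp [h.coef_left j hj]
  · refine mul_le_mul_of_nonneg_left ?_ (norm_nonneg _)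
    rw [coef_star, RCLike.norm_conj]
    refine (hC _).trans (mul_le_mul_of_nonneg_left ?_ hC0)
    -- For `j ≥ 0` the coefficient of `E` involved has index `j + k ≥ k`.
    exact zpow_le_zpow_right_of_le_one₀ hr0 hr1.le (by omega)

lemma tsum_coef_lowPart_le (h : OuterPair D E) {C r : ℝ} (hr0 : 0 < r) (hr1 : r < 1)
    (hC : ∀ k : ℤ, ‖coef E k‖ ≤ C * r ^ k) : ∃ K, ∀ n : ℕ,
    ∑' k, ‖coef (lowPart (D * star E) n) k‖ ≤ K * r ^ n := by
  refine ⟨(∑' j, ‖coef D j‖) * C * r * (1 - r)⁻¹, fun n => ?_⟩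
  refine (summable_and_tsum_norm_le_of_geometric (b := coef (lowPart (D * star E) n)) (n := n)
    (K := (∑' j, ‖coef D j‖) * C * r ^ (n + 1)) hr0.le hr1 (fun k hk => ?_) fun i => ?_).2.trans_eq ?_
  · rw [coef_lowPart h.summable_scattering, if_neg (by omega)]
  · rw [coef_lowPart h.summable_scattering, if_pos (by omega)]
    have := h.norm_coef_scattering_le hr0 hr1 hC (n + 1 + i : ℕ)
    rw [zpow_natCast, pow_add, ← mul_assoc] at this
    convert this using 4
    push_cast
    ring
  · ring

lemma norm_trialError_le (h : OuterPair D E) {C r : ℝ} (hr0 : 0 < r) (hr1 : r < 1)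
    (hC : ∀ k : ℤ, ‖coef E k‖ ≤ C * r ^ k) : ∃ K, ∀ n : ℕ,
    ‖trialError D E n‖ ≤ K * r ^ (2 * n) := by
  have hC0 : 0 ≤ C := by simpa using (norm_nonneg _).trans (hC 0)
  obtain ⟨K, hK⟩ := h.tsum_coef_lowPart_le hr0 hr1 hC
  refine ⟨K * C * r ^ 2 * (1 - r)⁻¹, fun n => ?_⟩
  have hlow := summable_coef_lowPart h.summable_scattering n
  -- For the error at `-1 - i`, a low index `j ≤ -n - 1` meets the coefficient of `E` at `1 + i - j
  -- ≥ n + 2 + i`. The low part supplies the other factor `r ^ n` through its `ℓ¹` norm.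
  have h1 := summable_and_tsum_norm_le_of_geometric (b := coef (trialError D E n)) (n := 0)
    (K := K * r ^ n * (C * r ^ (n + 2))) hr0.le hr1
    (fun k hk => h.coef_trialError_of_nonneg n (by omega)) fun i => ?_
  · refine (norm_le_tsum_coef h1.1).trans (h1.2.trans_eq ?_)
    ring
  rw [h.coef_trialError_of_neg n (by omega), RCLike.norm_conj]
  have h2 := hasSum_coef_mul (hasSum_coef hlow) E (-(-0 - 1 - (i : ℤ)))
  refine (h2.norm_le_of_bounded (hlow.hasSum.mul_right (C * r ^ (n + 2) * r ^ i)) fun j => ?_).trans ?_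
  · rw [norm_mul]
    by_cases hj : j ≤ -n - 1
    · refine mul_le_mul_of_nonneg_left ((hC _).trans ?_) (norm_nonneg _)
      rw [mul_assoc, ← pow_add, ← zpow_natCast]
      refine mul_le_mul_of_nonneg_left ?_ hC0
      exact zpow_le_zpow_right_of_le_one₀ hr0 hr1.le (by push_cast; omega)
    · simp [coef_lowPart h.summable_scattering, hj]
  · rw [mul_assoc (K * r ^ n)]
    exact mul_le_mul_of_nonneg_right (hK n) (by positivity)

/-- If `x n` is the maximum of `|M(D Q)|² / M(|D Q|²)` over polynomials `Q` of degree at most `n`,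
then `x n` is the mean square of the high part of the scattering function, up to a small error. -/
lemma extremal_isBigO (h : OuterPair D E) {C r : ℝ} (hr0 : 0 < r) (hr1 : r < 1)
    (hC : ∀ k : ℤ, ‖coef E k‖ ≤ C * r ^ k) {x : ℕ → ℝ}
    (hupper : ∀ n, x n ≤ meanSq (highPart D E n))
    (hlower : ∀ (n : ℕ) (c : ℕ → ℂ),
      ‖mean (D * ∑ k ∈ Finset.range (n + 1), c k • zpowMap k)‖ ^ 2
        ≤ x n * meanSq (D * ∑ k ∈ Finset.range (n + 1), c k • zpowMap k)) :
    (fun n => x n - meanSq (highPart D E n)) =O[atTop] fun n => r ^ (4 * n) := by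
  obtain ⟨K, hK⟩ := h.norm_trialError_le hr0 hr1 hC
  obtain ⟨K', hK'⟩ := h.tsum_coef_lowPart_le hr0 hr1 hC
  have hδ : ∀ n, meanSq (D * trialError D E n) ≤ (‖D‖ * K) ^ 2 * r ^ (4 * n) := fun n => by
    refine (meanSq_le_norm_sq _).trans ?_
    have : ‖D * trialError D E n‖ ≤ ‖D‖ * (K * r ^ (2 * n)) :=
      (norm_mul_le _ _).trans (mul_le_mul_of_nonneg_left (hK n) (norm_nonneg _))
    refine (pow_le_pow_left₀ (norm_nonneg _) this 2).trans_eq ?_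
    ring
  have hlow : ∀ n : ℕ, meanSq (lowPart (D * star E) n) ≤ K' ^ 2 * (r ^ 2) ^ n := fun n => by
    refine (meanSq_le_norm_sq _).trans ?_
    refine (pow_le_pow_left₀ (norm_nonneg _) ((norm_le_tsum_coef
      (summable_coef_lowPart h.summable_scattering n)).trans (hK' n)) 2).trans_eq ?_
    ring
  have hlim : ∀ (q c : ℝ), 0 ≤ q → q < 1 → Tendsto (fun n : ℕ => c * q ^ n) atTop (𝓝 0) :=
    fun q c h0 h1 => by simpa using (tendsto_pow_atTop_nhds_zero_of_lt_one h0 h1).const_mul c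
  -- For large `n`, `A > 3/4` and `δ < 1/64`. As `A ≤ 1`, this gives `|m - A| ≤ 1/8`, hence `den ≥ A
  -- - 1/4 ≥ 1/2`.
  have ev1 := (hlim (r ^ 2) (K' ^ 2) (by positivity)
    (pow_lt_one₀ hr0.le hr1 two_ne_zero)).eventually_lt_const (show (0 : ℝ) < 1 / 4 by norm_num)
  have ev2 := (hlim (r ^ 4) ((‖D‖ * K) ^ 2) (by positivity)
    (pow_lt_one₀ hr0.le hr1 four_ne_zero)).eventually_lt_const (show (0 : ℝ) < 1 / 64 by norm_num)
  refine IsBigO.of_bound (2 * (‖D‖ * K) ^ 2) ?_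
  filter_upwards [ev1, ev2] with n h1 h2
  rw [← pow_mul] at h2
  have hd := hδ n
  have hA := h.meanSq_highPart n
  have hA1 := meanSq_nonneg (lowPart (D * star E) n)
  have hA2 := hlow n
  have hδ0 := meanSq_nonneg (D * trialError D E n)
  have hden := h.meanSq_mul_trial n
  have hm := h.norm_mean_mul_trial_sub_sq_le n
  have hu := hupper n
  have hl := hlower n (fun k : ℕ => coef (star E * star (highPart D E n)) k)
  change ‖mean (D * trial D E n)‖ ^ 2 ≤ x n * meanSq (D * trial D E n) at hl
  set A := meanSq (highPart D E n)
  set m := mean (D * trial D E n)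
  set den := meanSq (D * trial D E n)
  set δ := meanSq (D * trialError D E n)
  have hm2 : ‖m - A‖ ^ 2 = ‖m‖ ^ 2 - 2 * A * m.re + A ^ 2 := by
    rw [Complex.sq_norm, Complex.sq_norm, Complex.normSq_apply, Complex.normSq_apply]
    simp
    ring
  have hre : A - m.re ≤ 1 / 8 := by
    have h3 : ‖m - A‖ ≤ 1 / 8 := by
      refine abs_le_of_sq_le_sq' ?_ (by norm_num) |>.2
      nlinarith
    have h4 := (Complex.abs_re_le_norm (m - A)).trans h3
    rw [Complex.sub_re, Complex.ofReal_re] at h4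
    linarith [(abs_le.1 h4).1]
  have hden2 : 1 / 2 ≤ den := by linarith
  -- From `|m|² = |m - A|² + 2 A Re m - A² ≥ A (den - δ)` and `|m|² ≤ x n * den`, with `A ≤ 1`.
  have hx : (A - x n) * den ≤ 1 * δ := by
    nlinarith [sq_nonneg ‖m - A‖]
  have hx2 : A - x n ≤ 2 * δ := by
    by_contra! h5
    nlinarith
  rw [Real.norm_of_nonpos (by linarith), Real.norm_of_nonneg (by positivity)]
  linarith

lemma tendsto_meanSq_highPart (h : OuterPair D E) {C r : ℝ} (hr0 : 0 < r) (hr1 : r < 1)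
    (hC : ∀ k : ℤ, ‖coef E k‖ ≤ C * r ^ k) :
    Tendsto (fun n : ℕ => meanSq (highPart D E n)) atTop (𝓝 1) := by
  obtain ⟨K, hK⟩ := h.tsum_coef_lowPart_le hr0 hr1 hC
  have h1 : Tendsto (fun n : ℕ => (K * r ^ n) ^ 2) atTop (𝓝 0) := by
    simpa using ((tendsto_pow_atTop_nhds_zero_of_lt_one hr0.le hr1).const_mul K).pow 2
  have h2 : Tendsto (fun n : ℕ => meanSq (lowPart (D * star E) n)) atTop (𝓝 0) := by
    refine squeeze_zero (fun n => meanSq_nonneg _) (fun n => ?_) h1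
    exact (meanSq_le_norm_sq _).trans (pow_le_pow_left₀ (norm_nonneg _) ((norm_le_tsum_coef
      (summable_coef_lowPart h.summable_scattering n)).trans (hK n)) 2)
  simp only [h.meanSq_highPart]
  simpa using h2.const_sub 1

end OuterPair

/-! ### Orthonormal polynomials -/

lemma eq_zero_of_meanSq_eq_zero {f : C(Circle, ℂ)} (hf : meanSq f = 0) : f = 0 := by
  by_contra hne
  obtain ⟨z, hz⟩ : ∃ z, f z ≠ 0 := by
    by_contra! h
    exact hne (ContinuousMap.ext h)
  have hcont : Continuous fun θ : ℝ => ‖f (Circle.exp θ)‖ ^ 2 :=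
    ((f.continuous.comp Circle.exp.continuous).norm).pow 2
  obtain ⟨θ, hθ, hθz⟩ : ∃ θ ∈ Set.Icc 0 (2 * π), Circle.exp θ = z := by
    obtain ⟨t, rfl⟩ := Circle.exp_surjective z
    refine ⟨toIcoMod Real.two_pi_pos 0 t, ?_, ?_⟩
    · have := toIcoMod_mem_Ico Real.two_pi_pos 0 t
      rw [zero_add] at this
      exact ⟨this.1, this.2.le⟩
    · rw [toIcoMod, zsmul_eq_mul]
      exact Circle.periodic_exp.sub_int_mul_eq _
  have hpos : 0 < ∫ θ in (0 : ℝ)..(2 * π), ‖f (Circle.exp θ)‖ ^ 2 :=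
    intervalIntegral.integral_pos Real.two_pi_pos hcont.continuousOn (fun _ _ => by positivity)
      ⟨θ, hθ, by rw [hθz]; positivity⟩
  have := mul_pos (show 0 < 1 / (2 * π) by positivity) hpos
  exact this.ne' hf

/-- A polynomial as a function on the unit circle. -/
noncomputable def onCircle : ℂ[X] →ₐ[ℂ] C(Circle, ℂ) := aeval (zpowMap 1)

lemma onCircle_apply (p : ℂ[X]) (z : Circle) : onCircle p z = p.eval (z : ℂ) := by
  rw [onCircle, aeval_continuousMap_apply]
  simp

lemma zpowMap_one_pow (k : ℕ) : zpowMap 1 ^ k = zpowMap k := by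
  ext z
  simp

lemma onCircle_eq_sum {p : ℂ[X]} {n : ℕ} (hp : p.natDegree ≤ n) :
    onCircle p = ∑ k ∈ Finset.range (n + 1), p.coeff k • zpowMap k := by
  rw [onCircle, aeval_eq_sum_range' (Nat.lt_succ_of_le hp)]
  simp only [zpowMap_one_pow]

lemma coef_onCircle {p : ℂ[X]} {n : ℕ} (hp : p.natDegree ≤ n) (k : ℤ) :
    coef (onCircle p) k = if 0 ≤ k ∧ k ≤ n then p.coeff k.toNat else 0 := by
  rw [onCircle_eq_sum hp, OuterPair.coef_sum_zpowMap]

lemma onCircle_eq_zero {p : ℂ[X]} (hp : onCircle p = 0) : p = 0 := by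
  ext k
  have h := coef_onCircle (le_max_left p.natDegree k) k
  rw [hp, if_pos ⟨by positivity, by exact_mod_cast le_max_right _ _⟩, Int.toNat_natCast] at h
  rw [← h]
  simp [coef]

variable {w : Circle → ℝ} {D : C(Circle, ℂ)}

lemma integral_weight (hw : ∀ z, w z = ‖D z‖ ^ 2) (p q : ℂ[X]) :
    (∫ θ in (0 : ℝ)..(2 * π), p.eval (Circle.exp θ : ℂ) *
      starRingEnd ℂ (q.eval (Circle.exp θ : ℂ)) * (w (Circle.exp θ) : ℂ))
      = 2 * π * mean (D * onCircle p * star (D * onCircle q)) := by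
  have hpi : (π : ℂ) ≠ 0 := by exact_mod_cast Real.pi_ne_zero
  rw [mean_apply, ← mul_assoc, mul_one_div_cancel (mul_ne_zero two_ne_zero hpi), one_mul]
  congr 1
  ext θ
  simp only [ContinuousMap.mul_apply, ContinuousMap.star_apply, onCircle_apply, hw, star_mul']
  push_cast
  rw [← Complex.mul_conj', ← starRingEnd_apply, ← starRingEnd_apply]
  ring

/-- The inner product on polynomials for the weight `|D|²`. -/
noncomputable abbrev weightCore (hD : ∀ z, D z ≠ 0) : InnerProductSpace.Core ℂ ℂ[X] where
  inner p q := 2 * π * mean (D * onCircle q * star (D * onCircle p))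
  conj_inner_symm p q := by
    rw [map_mul, ← mean_star, star_mul', star_star, mul_comm (star _), ← Complex.ofReal_ofNat,
      ← Complex.ofReal_mul, Complex.conj_ofReal]
  re_inner_nonneg p := by
    rw [mean_mul_star_self]
    have := mul_nonneg Real.two_pi_pos.le (meanSq_nonneg (D * onCircle p))
    exact_mod_cast this
  add_left p q r := by
    simp only [map_add, mul_add, star_add]
  smul_left p q c := by
    rw [map_smul, mul_smul_comm, star_smul, mul_smul_comm, map_smul, smul_eq_mul,
      starRingEnd_apply]
    ring
  definite p hp := by
    rw [mean_mul_star_self] at hp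
    have h1 : meanSq (D * onCircle p) = 0 := by
      have : (2 * π * meanSq (D * onCircle p) : ℝ) = 0 := by exact_mod_cast hp
      exact (mul_eq_zero.1 this).resolve_left Real.two_pi_pos.ne'
    refine onCircle_eq_zero (ContinuousMap.ext fun z => ?_)
    have h2 := DFunLike.congr_fun (eq_zero_of_meanSq_eq_zero h1) z
    exact (mul_eq_zero.1 h2).resolve_left (hD z)

lemma exists_orthonormal_polynomials (hw : ∀ z, w z = ‖D z‖ ^ 2) (hD : ∀ z, D z ≠ 0) :
    ∃ φ : ℕ → ℂ[X], IsOrthonormalPolynomials w φ := by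
  let c : InnerProductSpace.Core ℂ ℂ[X] := weightCore hD
  let : NormedAddCommGroup ℂ[X] := c.toNormedAddCommGroup
  let : InnerProductSpace ℂ ℂ[X] := InnerProductSpace.ofCore c.toCore
  have hli : LinearIndependent ℂ fun n : ℕ => (X : ℂ[X]) ^ n := by
    simpa [← X_pow_eq_monomial] using (Polynomial.basisMonomials ℂ).linearIndependent
  set g := InnerProductSpace.gramSchmidt ℂ fun n : ℕ => (X : ℂ[X]) ^ n with hg
  have hmonic : ∀ n, (g n).Monic ∧ (g n).natDegree = n := fun n => by
    induction n using Nat.strong_induction_on with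
    | _ n ih =>
      have h1 : g n = X ^ n - ∑ i ∈ Finset.Iio n, (ℂ ∙ g i).starProjection (X ^ n) :=
        InnerProductSpace.gramSchmidt_def ℂ _ n
      have h2 : (∑ i ∈ Finset.Iio n, (ℂ ∙ g i).starProjection ((X : ℂ[X]) ^ n)).degree < n := by
        refine mem_degreeLT.1 (Submodule.sum_mem _ fun i hi => ?_)
        rw [Submodule.starProjection_singleton]
        refine Submodule.smul_mem _ _ (mem_degreeLT.2 ?_)
        rw [Finset.mem_Iio] at hi
        rw [degree_eq_natDegree (ih i hi).1.ne_zero, (ih i hi).2]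
        exact_mod_cast hi
      rw [h1]
      refine ⟨monic_X_pow_sub h2, ?_⟩
      refine natDegree_eq_of_degree_eq_some ?_
      rw [degree_sub_eq_left_of_degree_lt] <;> rw [degree_X_pow]
      exact h2
  have hgn : ∀ n, ‖g n‖ ≠ 0 := fun n => norm_ne_zero_iff.2 (hmonic n).1.ne_zero
  have hφ : ∀ n, InnerProductSpace.gramSchmidtNormed ℂ (fun n : ℕ => (X : ℂ[X]) ^ n) n
      = ((‖g n‖ : ℂ)⁻¹) • g n := fun n => rfl
  refine ⟨InnerProductSpace.gramSchmidtNormed ℂ fun n : ℕ => (X : ℂ[X]) ^ n, ?_, ?_, ?_⟩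
  · intro n
    rw [hφ, natDegree_smul_of_smul_regular, (hmonic n).2]
    exact IsSMulRegular.of_ne_zero (inv_ne_zero (by exact_mod_cast hgn n))
  · intro n
    refine ⟨‖g n‖⁻¹, inv_pos.2 ((norm_nonneg _).lt_of_ne' (hgn n)), ?_⟩
    rw [hφ, smul_eq_C_mul, leadingCoeff_mul, leadingCoeff_C, (hmonic n).1.leadingCoeff]
    simp
  · intro n m
    -- The indices are swapped because the inner product is conjugate-linear in its first argument.
    have h1 := orthonormal_iff_ite.1 (InnerProductSpace.gramSchmidtNormed_orthonormal hli) m n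
    rw [integral_weight hw]
    refine Eq.trans h1 ?_
    simp only [eq_comm]

lemma mean_mul_onCircle_eq {φ : ℕ → ℂ[X]} (hφ : IsOrthonormalPolynomials w φ)
    (hw : ∀ z, w z = ‖D z‖ ^ 2) (n m : ℕ) :
    2 * π * mean (D * onCircle (φ n) * star (D * onCircle (φ m))) = if n = m then 1 else 0 := by
  rw [← integral_weight hw, hφ.orthonormal]

lemma IsOrthonormalPolynomials.kappa_pos {φ : ℕ → ℂ[X]} (hφ : IsOrthonormalPolynomials w φ)
    (n : ℕ) : 0 < kappa φ n := by
  obtain ⟨κ, h1, h2⟩ := hφ.leadingCoeff_pos n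
  rwa [kappa, h2, Complex.ofReal_re]

lemma IsOrthonormalPolynomials.coeff_self {φ : ℕ → ℂ[X]} (hφ : IsOrthonormalPolynomials w φ)
    (n : ℕ) : (φ n).coeff n = kappa φ n := by
  obtain ⟨κ, h1, h2⟩ := hφ.leadingCoeff_pos n
  rw [kappa, h2, Complex.ofReal_re, ← h2, leadingCoeff, hφ.natDegree_eq]

lemma IsOrthonormalPolynomials.degree_sub_lt {φ : ℕ → ℂ[X]} (hφ : IsOrthonormalPolynomials w φ)
    {n : ℕ} {p : ℂ[X]} (hp : p.degree ≤ n) :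
    (p - (p.coeff n / kappa φ n) • φ n).degree < n := by
  rw [degree_lt_iff_coeff_zero]
  intro m hm
  rw [coeff_sub, coeff_smul, smul_eq_mul]
  rcases hm.eq_or_lt with rfl | hm
  · rw [hφ.coeff_self, div_mul_cancel₀ _ (by exact_mod_cast (hφ.kappa_pos n).ne'), sub_self]
  · have h : (φ n).coeff m = 0 := coeff_eq_zero_of_natDegree_lt (by rwa [hφ.natDegree_eq])
    rw [h, coeff_eq_zero_of_degree_lt (hp.trans_lt (by exact_mod_cast hm)), mul_zero, sub_zero]

/-- Strip off the top coefficient with a multiple of `φ m`, which is orthogonal to `φ n` for `m <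
n`, and induct on the degree bound. -/
lemma IsOrthonormalPolynomials.mean_eq_zero_of_degree_lt {φ : ℕ → ℂ[X]}
    (hφ : IsOrthonormalPolynomials w φ) (hw : ∀ z, w z = ‖D z‖ ^ 2) {n m : ℕ} (hmn : m ≤ n)
    {p : ℂ[X]} (hp : p.degree < m) : mean (D * onCircle p * star (D * onCircle (φ n))) = 0 := by
  induction m generalizing p with
  | zero =>
    rw [Nat.cast_zero, ← not_le, zero_le_degree_iff, not_not] at hp
    simp [hp]
  | succ m ih =>
    have h1 := ih (by omega) (hφ.degree_sub_lt (n := m) (Order.lt_succ_iff.1 (by exact_mod_cast hp)))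
    have h2 := mean_mul_onCircle_eq hφ hw m n
    rw [if_neg (by omega)] at h2
    have h3 := (mul_eq_zero.1 h2).resolve_left (by exact_mod_cast Real.two_pi_pos.ne')
    rw [map_sub, map_smul, mul_sub, sub_mul, map_sub, mul_smul_comm, smul_mul_assoc, map_smul, h3,
      smul_zero, sub_zero] at h1
    exact h1

lemma IsOrthonormalPolynomials.mean_mul_star {φ : ℕ → ℂ[X]}
    (hφ : IsOrthonormalPolynomials w φ) (hw : ∀ z, w z = ‖D z‖ ^ 2) {n : ℕ}
    {p : ℂ[X]} (hp : p.degree ≤ n) :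
    2 * π * mean (D * onCircle p * star (D * onCircle (φ n))) = p.coeff n / kappa φ n := by
  have h1 := hφ.mean_eq_zero_of_degree_lt hw le_rfl (hφ.degree_sub_lt hp)
  rw [map_sub, map_smul, mul_sub, sub_mul, map_sub, mul_smul_comm, smul_mul_assoc, map_smul,
    sub_eq_zero] at h1
  have h2 := mean_mul_onCircle_eq hφ hw n n
  rw [if_pos rfl] at h2
  rw [h1, smul_eq_mul, mul_left_comm, h2, mul_one]

lemma IsOrthonormalPolynomials.meanSq_eq {φ : ℕ → ℂ[X]} (hφ : IsOrthonormalPolynomials w φ)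
    (hw : ∀ z, w z = ‖D z‖ ^ 2) (n : ℕ) : 2 * π * meanSq (D * onCircle (φ n)) = 1 := by
  have h2 := mean_mul_onCircle_eq hφ hw n n
  rw [if_pos rfl, mean_mul_star_self] at h2
  exact_mod_cast h2

/-- The functional `p ↦ p.coeff n` is represented by `κ_n φ_n`, so this is Cauchy–Schwarz: the
extremal property of the leading coefficient. -/
lemma IsOrthonormalPolynomials.norm_coeff_sq_le {φ : ℕ → ℂ[X]}
    (hφ : IsOrthonormalPolynomials w φ) (hw : ∀ z, w z = ‖D z‖ ^ 2) {n : ℕ}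
    {p : ℂ[X]} (hp : p.degree ≤ n) :
    ‖p.coeff n‖ ^ 2 ≤ 2 * π * kappa φ n ^ 2 * meanSq (D * onCircle p) := by
  have h1 := norm_mean_mul_star_sq_le (D * onCircle p) (D * onCircle (φ n))
  have h2 := hφ.mean_mul_star hw hp
  have h3 := hφ.meanSq_eq hw n
  have hκ := hφ.kappa_pos n
  have h4 : p.coeff n
      = kappa φ n * (2 * π * mean (D * onCircle p * star (D * onCircle (φ n)))) := by
    rw [h2, mul_div_cancel₀ _ (by exact_mod_cast hκ.ne')]
  have h5 : ‖p.coeff n‖ = kappa φ n * (2 * π * ‖mean (D * onCircle p * star (D * onCircle (φ n)))‖) := by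
    conv_lhs => rw [h4]
    simp [abs_of_pos hκ, abs_of_pos Real.pi_pos]
  rw [h5]
  calc _ = kappa φ n ^ 2 * (2 * π) ^ 2 * ‖mean (D * onCircle p * star (D * onCircle (φ n)))‖ ^ 2 := by ring
    _ ≤ kappa φ n ^ 2 * (2 * π) ^ 2 * (meanSq (D * onCircle p) * meanSq (D * onCircle (φ n))) := by gcongr
    _ = 2 * π * kappa φ n ^ 2 * meanSq (D * onCircle p) * (2 * π * meanSq (D * onCircle (φ n))) := by ring
    _ = _ := by rw [h3, mul_one]

/-! ### The leading coefficient as an extremal value -/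

lemma meanSq_congr {f g : C(Circle, ℂ)} (h : ∀ z, ‖f z‖ = ‖g z‖) : meanSq f = meanSq g := by
  simp only [meanSq, h]

lemma meanSq_mul_star_mul_zpowMap (D f : C(Circle, ℂ)) (n : ℤ) :
    meanSq (D * (star f * zpowMap n)) = meanSq (D * f) :=
  meanSq_congr fun z => by
    simp only [ContinuousMap.mul_apply, ContinuousMap.star_apply, zpowMap_apply, norm_mul, norm_star,
      norm_zpow, Circle.norm_coe, one_zpow, mul_one]

/-- The reversed polynomial of `φ n` is a competitor whose constant term is `κ_n`. -/
lemma kappa_sq_le {E : C(Circle, ℂ)} (h : OuterPair D E) (hw : ∀ z, w z = ‖D z‖ ^ 2)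
    {φ : ℕ → ℂ[X]} (hφ : IsOrthonormalPolynomials w φ) (n : ℕ) :
    2 * π * ‖mean D‖ ^ 2 * kappa φ n ^ 2 ≤ meanSq (OuterPair.highPart D E n) := by
  set Q := star (onCircle (φ n)) * zpowMap n with hQ
  have hcoef : ∀ k, coef Q k = starRingEnd ℂ (coef (onCircle (φ n)) (n - k)) := fun k => by
    rw [hQ, coef_mul_zpowMap, coef_star, neg_sub]
  have hdeg := (hφ.natDegree_eq n).le
  have h1 := h.norm_mean_sq_le (Q := Q) (n := n) fun k hk => by
    rw [hcoef, coef_onCircle hdeg, if_neg (by omega), map_zero]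
  have h2 := h.mean_mul (Q := Q) fun k hk => by
    rw [hcoef, coef_onCircle hdeg, if_neg (by omega), map_zero]
  have h3 : mean Q = kappa φ n := by
    rw [← coef_zero_index, hcoef, coef_onCircle hdeg, if_pos (by omega)]
    simp [hφ.coeff_self]
  have h4 := hφ.meanSq_eq hw n
  rw [h2, h3, meanSq_mul_star_mul_zpowMap, norm_mul, mul_pow, Complex.norm_real, Real.norm_eq_abs,
    sq_abs] at h1
  calc _ = 2 * π * (‖mean D‖ ^ 2 * kappa φ n ^ 2) := by ring
    _ ≤ 2 * π * (meanSq (D * onCircle (φ n)) * meanSq (OuterPair.highPart D E n)) := by gcongr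
    _ = 2 * π * meanSq (D * onCircle (φ n)) * meanSq (OuterPair.highPart D E n) := by ring
    _ = _ := by rw [h4, one_mul]

lemma le_kappa_sq {E : C(Circle, ℂ)} (h : OuterPair D E) (hw : ∀ z, w z = ‖D z‖ ^ 2)
    {φ : ℕ → ℂ[X]} (hφ : IsOrthonormalPolynomials w φ) (n : ℕ) (c : ℕ → ℂ) :
    ‖mean (D * ∑ k ∈ Finset.range (n + 1), c k • zpowMap k)‖ ^ 2
      ≤ 2 * π * ‖mean D‖ ^ 2 * kappa φ n ^ 2
        * meanSq (D * ∑ k ∈ Finset.range (n + 1), c k • zpowMap k) := by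
  set Q := ∑ k ∈ Finset.range (n + 1), c k • zpowMap k with hQ
  have hcoef : ∀ k : ℤ, coef Q k = if 0 ≤ k ∧ k ≤ n then c k.toNat else 0 :=
    OuterPair.coef_sum_zpowMap c n
  -- The reversal of `Q`: its coefficient of index `n` is the conjugate of the constant term of `Q`.
  let p : ℂ[X] := ∑ k ∈ Finset.range (n + 1), C (starRingEnd ℂ (c k)) * X ^ (n - k)
  have hp : onCircle p = star Q * zpowMap n := by
    simp only [p, hQ, map_sum, star_sum, Finset.sum_mul]
    refine Finset.sum_congr rfl fun k hk => ?_
    rw [Finset.mem_range] at hk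
    rw [star_smul, star_zpowMap, smul_mul_assoc, ← zpowMap_add, ← smul_eq_C_mul, map_smul, onCircle,
      map_pow, aeval_X, zpowMap_one_pow, starRingEnd_apply]
    congr 2
    omega
  have hdeg : p.natDegree ≤ n :=
    natDegree_sum_le_of_forall_le _ _ fun k _ => (natDegree_C_mul_X_pow_le _ _).trans (by omega)
  have h1 := hφ.norm_coeff_sq_le hw (degree_le_of_natDegree_le hdeg)
  have h2 := h.mean_mul (Q := Q) fun k hk => by rw [hcoef, if_neg (by omega)]
  have h3 : p.coeff n = starRingEnd ℂ (mean Q) := by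
    have := coef_onCircle hdeg n
    rw [if_pos (by omega), Int.toNat_natCast, hp, coef_mul_zpowMap, sub_self, coef_star, neg_zero,
      coef_zero_index] at this
    exact this.symm
  rw [h3, RCLike.norm_conj, hp, meanSq_mul_star_mul_zpowMap] at h1
  rw [h2, norm_mul, mul_pow]
  calc _ ≤ ‖mean D‖ ^ 2 * (2 * π * kappa φ n ^ 2 * meanSq (D * Q)) := by gcongr
    _ = _ := by ring

/-! ### Laurent coefficients of holomorphic functions -/

lemma isOpen_ring (t R : ℝ) : IsOpen {z : ℂ | t < ‖z‖ ∧ ‖z‖ < R} :=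
  (isOpen_lt continuous_const continuous_norm).inter (isOpen_lt continuous_norm continuous_const)

/-- The Cauchy estimate obtained by moving the contour to the circle of radius `r⁻¹`. -/
lemma exists_norm_coef_le {f : ℂ → ℂ} {g : C(Circle, ℂ)} {t s r : ℝ} (ht : t < 1) (hs : 0 < s)
    (hsr : s < r) (hr : r < 1) (hf : DifferentiableOn ℂ f {z | t < ‖z‖ ∧ ‖z‖ < s⁻¹})
    (hfg : ∀ z : Circle, f z = g z) : ∃ C, ∀ k : ℤ, ‖coef g k‖ ≤ C * r ^ k := by
  have hr0 : 0 < r := hs.trans hsr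
  have hr1 : 1 < r⁻¹ := (one_lt_inv₀ hr0).2 hr
  have hrs : r⁻¹ < s⁻¹ := (inv_lt_inv₀ hr0 hs).2 hsr
  have hsub : Metric.closedBall (0 : ℂ) r⁻¹ \ Metric.ball 0 1 ⊆ {z | t < ‖z‖ ∧ ‖z‖ < s⁻¹} := by
    rintro z ⟨h1, h2⟩
    rw [mem_closedBall_zero_iff] at h1
    rw [mem_ball_zero_iff, not_lt] at h2
    exact ⟨by linarith, by linarith⟩
  have hcoef : ∀ k : ℤ, coef g k
      = (2 * π * Complex.I : ℂ)⁻¹ • ∮ z in C(0, 1), f z * z ^ (-k - 1) := fun k => by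
    have h1 : ∮ z in C(0, 1), f z * z ^ (-k - 1)
        = Complex.I * ∫ θ in (0 : ℝ)..(2 * π), (g * zpowMap (-k)) (Circle.exp θ) := by
      rw [circleIntegral, ← intervalIntegral.integral_const_mul]
      refine intervalIntegral.integral_congr fun θ _ => ?_
      have hz : circleMap 0 1 θ = (Circle.exp θ : ℂ) := by simp [circleMap]
      have hne := Circle.coe_ne_zero (Circle.exp θ)
      simp only [deriv_circleMap, ContinuousMap.mul_apply, zpowMap_apply, ← hfg, hz, smul_eq_mul]
      rw [zpow_sub₀ hne, zpow_one]
      field_simp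
    have hpi : (π : ℂ) ≠ 0 := by exact_mod_cast Real.pi_ne_zero
    rw [coef, mean_apply, h1, smul_eq_mul]
    field_simp [Complex.I_ne_zero]
  have hshift : ∀ k : ℤ, ∮ z in C(0, 1), f z * z ^ (-k - 1)
      = ∮ z in C(0, r⁻¹), f z * z ^ (-k - 1) := fun k => by
    -- `t` may be negative; `max t 0` keeps the origin, where the power is singular, outside the
    -- region.
    have hd : DifferentiableOn ℂ (fun z => f z * z ^ (-k - 1))
        {z | max t 0 < ‖z‖ ∧ ‖z‖ < s⁻¹} := by
      refine (hf.mono fun z hz => ⟨(le_max_left _ _).trans_lt hz.1, hz.2⟩).mul fun z hz => ?_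
      have hz0 : z ≠ 0 := norm_pos_iff.1 ((le_max_right _ _).trans_lt hz.1)
      exact (differentiableAt_zpow.2 (Or.inl hz0)).differentiableWithinAt
    have hsub' : Metric.closedBall (0 : ℂ) r⁻¹ \ Metric.ball 0 1
        ⊆ {z | max t 0 < ‖z‖ ∧ ‖z‖ < s⁻¹} := fun z hz => by
      refine ⟨max_lt (hsub hz).1 ?_, (hsub hz).2⟩
      have := hz.2
      rw [mem_ball_zero_iff, not_lt] at this
      linarith
    refine (Complex.circleIntegral_eq_of_differentiable_on_annulus_off_countable one_pos hr1.le
      Set.countable_empty (hd.continuousOn.mono hsub') fun z hz => ?_).symm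
    refine hd.differentiableAt ((isOpen_ring _ _).mem_nhds (hsub' ?_))
    exact ⟨Metric.ball_subset_closedBall hz.1.1, fun h => hz.1.2 (Metric.ball_subset_closedBall h)⟩
  have hsub3 : Metric.sphere (0 : ℂ) r⁻¹ ⊆ {z | t < ‖z‖ ∧ ‖z‖ < s⁻¹} := fun z hz => by
    rw [mem_sphere_zero_iff_norm] at hz
    exact ⟨by rw [hz]; linarith, by rw [hz]; exact hrs⟩
  obtain ⟨C, hC⟩ := (isCompact_sphere (0 : ℂ) r⁻¹).exists_bound_of_continuousOn
    (hf.continuousOn.mono hsub3)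
  refine ⟨C, fun k => ?_⟩
  rw [hcoef, hshift]
  refine (circleIntegral.norm_two_pi_i_inv_smul_integral_le_of_norm_le_const
    (C := C * (r⁻¹) ^ (-k - 1)) (inv_pos.2 hr0).le fun z hz => ?_).trans_eq ?_
  · rw [norm_mul, norm_zpow, mem_sphere_zero_iff_norm.1 hz]
    exact mul_le_mul_of_nonneg_right (hC z hz) (by positivity)
  · rw [zpow_sub₀ (inv_pos.2 hr0).ne', inv_zpow, zpow_neg, inv_inv, zpow_one]
    field_simp

lemma hasSum_of_forall_hasSum {ι : Type*} {b : ι → ℂ} {m : ι → ℤ} (hb : Summable fun k => ‖b k‖)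
    {g : C(Circle, ℂ)} (hg : ∀ z : Circle, HasSum (fun k => b k * (z : ℂ) ^ m k) (g z)) :
    HasSum (fun k => b k • zpowMap (m k)) g := by
  have hs : Summable fun k => b k • zpowMap (m k) :=
    Summable.of_norm (by simpa only [norm_smul, norm_zpowMap, mul_one] using hb)
  convert hs.hasSum
  ext z
  refine (hg z).unique ?_
  simpa [ContinuousMap.evalCLM] using (ContinuousMap.evalCLM ℂ z).hasSum hs.hasSum

lemma exists_powerSeries {F : ℂ → ℂ} {R : ℝ} (hF : DifferentiableOn ℂ F (Metric.ball 0 R)) :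
    ∃ a : ℕ → ℂ, ∀ z ∈ Metric.ball (0 : ℂ) R, HasSum (fun n => a n * z ^ n) (F z) := by
  refine ⟨fun n => (n.factorial : ℂ)⁻¹ * iteratedDeriv n F 0, fun z hz => ?_⟩
  refine (Complex.hasSum_taylorSeries_on_ball hF hz).congr_fun fun n => ?_
  rw [sub_zero, smul_eq_mul, smul_eq_mul]
  ring

/-- The Fourier series of the restriction to the circle of a function that is holomorphic in a
larger disc is its Taylor series. -/
lemma coef_of_differentiableOn_ball {F : ℂ → ℂ} {R : ℝ} (hR : 1 < R)
    (hF : DifferentiableOn ℂ F (Metric.ball 0 R)) {g : C(Circle, ℂ)}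
    (hg : ∀ z : Circle, F z = g z) :
    (Summable fun k => ‖coef g k‖) ∧ (∀ k < 0, coef g k = 0) ∧ coef g 0 = F 0 ∧
      ∀ z : ℂ, z ≠ 0 → ‖z‖ < R → HasSum (fun k : ℤ => coef g k * z ^ k) (F z) := by
  obtain ⟨a, ha⟩ := exists_powerSeries hF
  have hmem : ∀ z : Circle, (z : ℂ) ∈ Metric.ball (0 : ℂ) R := fun z => by
    rwa [mem_ball_zero_iff, Circle.norm_coe]
  have hsum : Summable fun n => ‖a n‖ := by
    simpa using (ha (1 : Circle) (hmem 1)).summable.norm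
  have hgs : HasSum (fun n : ℕ => a n • zpowMap n) g :=
    hasSum_of_forall_hasSum hsum fun z => by
      rw [← hg]
      simpa only [zpow_natCast] using ha z (hmem z)
  set b : ℤ → ℂ := fun k => if 0 ≤ k then a k.toNat else 0 with hb
  have hbn : ∀ n : ℕ, b n = a n := fun n => by simp [hb]
  have hb0 : ∀ k, k ∉ Set.range (Nat.cast : ℕ → ℤ) → b k = 0 := fun k hk => by
    simp only [hb]
    rw [if_neg]
    intro h
    exact hk ⟨k.toNat, by omega⟩
  have hinj : Function.Injective (Nat.cast : ℕ → ℤ) := Nat.cast_injective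
  have hbs : HasSum (fun k => b k • zpowMap k) g := by
    rw [← hinj.hasSum_iff fun k hk => by rw [hb0 k hk, zero_smul]]
    refine hgs.congr_fun fun n => ?_
    simp [hbn]
  have hcoef : ∀ k, coef g k = b k := coef_eq_of_hasSum hbs
  simp only [hcoef]
  refine ⟨?_, fun k hk => by simp [hb, hk.not_ge], ?_, fun z hz0 hz => ?_⟩
  · rw [← hinj.summable_iff fun k hk => by rw [hb0 k hk, norm_zero]]
    simpa [Function.comp_def, hbn] using hsum
  · have h1 := ha 0 (Metric.mem_ball_self (by linarith))
    have h2 := hbn 0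
    rw [Nat.cast_zero] at h2
    rw [h2]
    refine (h1.unique ?_).symm
    convert hasSum_ite_eq 0 (a 0) using 2 with n
    rcases n.eq_zero_or_pos with rfl | hn
    · simp
    · simp [hn.ne']
  · rw [← hinj.hasSum_iff fun k hk => by rw [hb0 k hk, zero_mul]]
    refine (ha z (by rwa [mem_ball_zero_iff])).congr_fun fun n => ?_
    simp [hbn]

/-- On each disc of radius `q < t⁻¹` the terms are dominated by a geometric series of ratio `t * q`.
-/
lemma differentiableOn_tsum_pow {c : ℕ → ℂ} {C t : ℝ} (ht : 0 < t)
    (hc : ∀ k, ‖c k‖ ≤ C * t ^ k) :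
    DifferentiableOn ℂ (fun z => ∑' k, c k * z ^ k) (Metric.ball 0 t⁻¹) := by
  intro z hz
  rw [mem_ball_zero_iff] at hz
  obtain ⟨q, hzq, hq⟩ := exists_between hz
  have hq0 : 0 ≤ q := (norm_nonneg z).trans hzq.le
  have hu : Summable fun k => C * (t * q) ^ k :=
    (summable_geometric_of_lt_one (by positivity)
      (by rwa [← one_div, lt_div_iff₀' ht] at hq)).mul_left C
  have h := Complex.differentiableOn_tsum_of_summable_norm (F := fun k z => c k * z ^ k)
    (U := Metric.ball (0 : ℂ) q) hu (fun k => by fun_prop) Metric.isOpen_ball fun k y hy => by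
      rw [mem_ball_zero_iff] at hy
      rw [norm_mul, norm_pow, mul_pow, ← mul_assoc]
      exact mul_le_mul (hc k) (pow_le_pow_left₀ (norm_nonneg _) hy.le _) (by positivity)
        ((norm_nonneg _).trans (hc k))
  exact (h.differentiableAt (Metric.isOpen_ball.mem_nhds
    (by rwa [mem_ball_zero_iff]))).differentiableWithinAt

lemma hasSum_tsum_pow {c : ℕ → ℂ} {C t : ℝ} (ht : 0 < t)
    (hc : ∀ k, ‖c k‖ ≤ C * t ^ k) {z : ℂ} (hz : ‖z‖ < t⁻¹) :
    HasSum (fun k => c k * z ^ k) (∑' k, c k * z ^ k) := by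
  refine Summable.hasSum (Summable.of_norm_bounded (g := fun k => C * (t * ‖z‖) ^ k)
    ((summable_geometric_of_lt_one (by positivity)
      (by rwa [← one_div, lt_div_iff₀' ht] at hz)).mul_left C) fun k => ?_)
  rw [norm_mul, norm_pow, mul_pow, ← mul_assoc]
  exact mul_le_mul_of_nonneg_right (hc k) (by positivity)

/-- The mean of `g` against the Herglotz kernel. -/
lemma exists_herglotz_kernel (g : C(Circle, ℂ)) {a : ℂ} (ha : ‖a‖ < 1) (m : ℤ) :
    ∃ K : C(Circle, ℂ), (∀ u : Circle, K u = (1 + a * (u : ℂ) ^ m) / (1 - a * (u : ℂ) ^ m)) ∧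
      mean (g * K) = 2 * (∑' n : ℕ, a ^ n * coef g (-(m * n))) - coef g 0 := by
  set x : C(Circle, ℂ) := a • zpowMap m with hx
  have hx1 : ‖x‖ < 1 := by rwa [hx, norm_smul, norm_zpowMap, mul_one]
  have hs := summable_geometric_of_norm_lt_one hx1
  have hG := mul_neg_geom_series x hx1
  have hpow : ∀ n : ℕ, x ^ n = a ^ n • zpowMap (m * n) := fun n => by
    ext z
    simp [hx, mul_pow, zpow_mul]
  -- `(1 + x) / (1 - x) = 2 ∑ x ^ n - 1`, convergent in the sup norm.
  refine ⟨2 * ∑' n, x ^ n - 1, fun u => ?_, ?_⟩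
  · have h1 := DFunLike.congr_fun hG u
    simp only [ContinuousMap.mul_apply, ContinuousMap.sub_apply, ContinuousMap.one_apply, hx,
      ContinuousMap.smul_apply, zpowMap_apply, smul_eq_mul] at h1
    have h2 : 1 - a * (u : ℂ) ^ m ≠ 0 := left_ne_zero_of_mul_eq_one h1
    rw [eq_div_iff h2]
    simp only [ContinuousMap.mul_apply, ContinuousMap.sub_apply, ContinuousMap.one_apply, hx]
    have h3 : (2 : C(Circle, ℂ)) u = 2 := rfl
    rw [h3]
    linear_combination 2 * h1
  · have h1 := mean.hasSum (hs.hasSum.mul_left g)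
    have h2 : HasSum (fun n : ℕ => a ^ n * coef g (-(m * n))) (mean (g * ∑' n, x ^ n)) :=
      h1.congr_fun fun n => by
        rw [hpow, mul_smul_comm, map_smul, mean_mul_zpowMap, smul_eq_mul]
    rw [h2.tsum_eq, coef_zero_index, mul_sub, mul_one, map_sub, mul_left_comm, two_mul, map_add,
      ← two_mul]

/-- The Cauchy product of two absolutely convergent bilateral series. -/
lemma hasSum_conv {α β γ : ℤ → ℂ} {A B : ℂ} (hα : HasSum α A) (hβ : HasSum β B)
    (hγ : ∀ k, HasSum (fun j => α j * β (k - j)) (γ k)) : HasSum γ (A * B) := by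
  have h1 : HasSum (fun p : ℤ × ℤ => α p.1 * β p.2) (A * B) :=
    hα.mul hβ (summable_mul_of_summable_norm hα.summable.norm hβ.summable.norm)
  -- Group the double series by the total index `k`.
  let e : ℤ × ℤ ≃ ℤ × ℤ :=
    { toFun := fun p => (p.2, p.1 - p.2)
      invFun := fun p => (p.1 + p.2, p.1)
      left_inv := fun p => by simp
      right_inv := fun p => by simp }
  exact (e.hasSum_iff.2 h1).prod_fiberwise hγ

/-! ### The Szegő function -/

lemma exists_annulus_subset {U : Set ℂ} (hU : IsOpen U) (h : Metric.sphere (0 : ℂ) 1 ⊆ U) :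
    ∃ t, 0 < t ∧ t < 1 ∧ annulus t ⊆ U := by
  obtain ⟨δ, hδ, hsub⟩ := (isCompact_sphere (0 : ℂ) 1).exists_thickening_subset_open hU h
  have h1 : (0 : ℝ) < 1 + δ := by linarith
  refine ⟨(1 + δ)⁻¹, inv_pos.2 h1, inv_lt_one_of_one_lt₀ (by linarith), fun z hz => hsub ?_⟩
  obtain ⟨hz1, hz2⟩ := hz
  rw [inv_inv] at hz2
  have hz0 : 0 < ‖z‖ := (inv_pos.2 h1).trans hz1
  have hz3 : 1 - δ < ‖z‖ := by
    refine lt_of_le_of_lt ?_ hz1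
    rw [← one_div, le_div_iff₀ h1]
    nlinarith
  rw [Metric.mem_thickening_iff]
  -- The radial projection of `z`, at distance `|‖z‖ - 1|`.
  refine ⟨((‖z‖⁻¹ : ℝ) : ℂ) * z, ?_, ?_⟩
  · rw [mem_sphere_zero_iff_norm, norm_mul, Complex.norm_real, norm_inv, norm_norm,
      inv_mul_cancel₀ hz0.ne']
  · have h2 : z - ((‖z‖⁻¹ : ℝ) : ℂ) * z = ((1 - ‖z‖⁻¹ : ℝ) : ℂ) * z := by
      push_cast
      ring
    rw [dist_eq_norm, h2, norm_mul, Complex.norm_real, Real.norm_eq_abs]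
    nth_rewrite 2 [← abs_of_pos hz0]
    rw [← abs_mul, sub_mul, inv_mul_cancel₀ hz0.ne', one_mul, abs_lt]
    constructor <;> linarith

lemma isOpen_annulus (s : ℝ) : IsOpen (annulus s) := isOpen_ring s s⁻¹

lemma coe_mem_annulus {s : ℝ} (hs : 0 < s) (hs1 : s < 1) (z : Circle) : (z : ℂ) ∈ annulus s := by
  constructor <;> rw [Circle.norm_coe]
  exacts [hs1, (one_lt_inv₀ hs).2 hs1]

lemma IsPositiveAnalyticWeight.exists_log (hw : IsPositiveAnalyticWeight w) :
    ∃ t, 0 < t ∧ t < 1 ∧ ∃ L : ℂ → ℂ, DifferentiableOn ℂ L (annulus t) ∧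
      ∀ z : Circle, L z = (Real.log (w z) : ℂ) := by
  obtain ⟨hpos, s, hs0, hs1, W, hW, hWw⟩ := hw
  -- Where the extension `W` has positive real part, the principal logarithm of `W` is holomorphic.
  have hopen : IsOpen (annulus s ∩ (fun z => (W z).re) ⁻¹' Set.Ioi 0) :=
    (Complex.continuous_re.comp_continuousOn hW.continuousOn).isOpen_inter_preimage
      (isOpen_annulus s) isOpen_Ioi
  obtain ⟨t, ht0, ht1, ht⟩ := exists_annulus_subset hopen fun z hz => by
    obtain ⟨u, rfl⟩ : ∃ u : Circle, (u : ℂ) = z := ⟨⟨z, hz⟩, rfl⟩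
    refine ⟨coe_mem_annulus hs0 hs1 u, ?_⟩
    have h : W u = (w u : ℂ) := hWw u
    rw [Set.mem_preimage, h, Complex.ofReal_re]
    exact hpos u
  refine ⟨t, ht0, ht1, fun z => Complex.log (W z), ?_, fun z => ?_⟩
  · exact (hW.mono fun z hz => (ht hz).1).clog fun z hz => Or.inl (ht hz).2
  · rw [Complex.ofReal_log (hpos z).le]
    exact congrArg Complex.log (hWw z)

/-- The analytic exponent `H` of the outer function `D_i = exp H`. -/
lemma IsPositiveAnalyticWeight.exists_exponent (hw : IsPositiveAnalyticWeight w) :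
    ∃ t, 0 < t ∧ t < 1 ∧ ∃ H : ℂ → ℂ, DifferentiableOn ℂ H (Metric.ball 0 t⁻¹) ∧
      (∀ z, ‖z‖ < 1 → szego w z = Complex.exp (H z)) ∧
      (∀ z, 1 < ‖z‖ →
        szego w z = Complex.exp (-(starRingEnd ℂ (H (starRingEnd ℂ z⁻¹))))) ∧
      (∀ u : Circle, H u + starRingEnd ℂ (H u) = (Real.log (w u) : ℂ)) ∧
      Complex.exp (H 0) = ((tau w)⁻¹ : ℝ) := by
  obtain ⟨t₀, ht₀, ht₁, L, hL, hLw⟩ := hw.exists_log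
  obtain ⟨t, htt, ht1⟩ := exists_between ht₁
  have ht0 : 0 < t := ht₀.trans htt
  let g : C(Circle, ℂ) := ⟨fun z => (Real.log (w z) : ℂ), by
    simp only [← hLw]
    exact hL.continuousOn.comp_continuous continuous_subtype_val (coe_mem_annulus ht₀ ht₁)⟩
  obtain ⟨C, hC⟩ := exists_norm_coef_le (g := g) ht₁ ht₀ htt ht1 hL hLw
  have hstar : star g = g := by
    ext z
    simp [g]
  have hneg : ∀ k, coef g (-k) = starRingEnd ℂ (coef g k) := fun k => by
    conv_lhs => rw [← hstar]
    rw [coef_star, neg_neg]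
  have hreal : starRingEnd ℂ (coef g 0) = coef g 0 := by rw [← hneg, neg_zero]
  have hCn : ∀ n : ℕ, ‖coef g n‖ ≤ C * t ^ n := fun n => by
    simpa only [zpow_natCast] using hC n
  have ht1' : 1 < t⁻¹ := (one_lt_inv₀ ht0).2 ht1
  -- The nonnegative-frequency half of `log w`. Its constant term is halved so that `H + conj H`
  -- counts the mean once.
  let H : ℂ → ℂ := fun z => (∑' n : ℕ, coef g n * z ^ n) - coef g 0 / 2
  have hpair : ∀ u : Circle, H u + starRingEnd ℂ (H u) = (Real.log (w u) : ℂ) := fun u => by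
    have h1 := hasSum_tsum_pow ht0 hCn (z := u) (by rwa [Circle.norm_coe])
    have h2 := (Complex.hasSum_conj'.2 h1)
    have h3 : HasSum (fun k : ℤ => coef g k * (u : ℂ) ^ k) _ :=
      HasSum.of_nat_of_neg (f := fun k : ℤ => coef g k * (u : ℂ) ^ k)
        (h1.congr_fun fun n => by rw [zpow_natCast]) (h2.congr_fun fun n => by
          rw [hneg, map_mul, map_pow, zpow_neg, zpow_natCast, ← Circle.coe_inv_eq_conj,
            Circle.coe_inv, inv_pow])
    have hsum : Summable fun k => ‖coef g k‖ := by
      simpa only [norm_mul, norm_zpow, Circle.norm_coe, one_zpow, mul_one] using h3.summable.norm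
    have h4 := (ContinuousMap.evalCLM ℂ u).hasSum (hasSum_coef hsum)
    have h5 : HasSum (fun k : ℤ => coef g k * (u : ℂ) ^ k) (g u) := by
      simpa [ContinuousMap.evalCLM] using h4
    have h6 := h3.unique h5
    simp only [zpow_zero, mul_one] at h6
    have h7 : g u = (Real.log (w u) : ℂ) := rfl
    rw [← h7, ← h6]
    simp only [H, map_sub, map_div₀, hreal, Complex.conj_ofNat]
    ring
  refine ⟨t, ht0, ht1, H, (differentiableOn_tsum_pow ht0 hCn).sub_const _, fun z hz => ?_,
    fun z hz => ?_, hpair, ?_⟩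
  -- Inside, `(u + z) / (u - z) = (1 + z u⁻¹) / (1 - z u⁻¹)`.
  · obtain ⟨K, hK1, hK2⟩ := exists_herglotz_kernel g hz (-1)
    have h1 : ∀ θ : ℝ, (Real.log (w (Circle.exp θ)) : ℂ) *
        (((Circle.exp θ : ℂ) + z) / ((Circle.exp θ : ℂ) - z)) = (g * K) (Circle.exp θ) := fun θ => by
      rw [ContinuousMap.mul_apply, hK1]
      have hne := Circle.coe_ne_zero (Circle.exp θ)
      change _ = (Real.log (w (Circle.exp θ)) : ℂ) * _
      congr 1
      rw [zpow_neg_one, ← mul_div_mul_right _ _ hne]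
      field_simp
    rw [szego]
    simp only [h1]
    congr 1
    have h2 : (1 / (4 * π) : ℂ) * ∫ θ in (0 : ℝ)..(2 * π), (g * K) (Circle.exp θ)
        = mean (g * K) / 2 := by
      rw [mean_apply]
      ring
    rw [h2, hK2]
    simp only [H, neg_mul, one_mul, neg_neg, mul_comm (z ^ _)]
    ring
  · have hz1 : ‖z⁻¹‖ < 1 := by
      rw [norm_inv]
      exact inv_lt_one_of_one_lt₀ hz
    have hz0 : z ≠ 0 := norm_pos_iff.1 (by linarith)
    -- Outside, `(u + z) / (u - z) = -(1 + z⁻¹ u) / (1 - z⁻¹ u)`; the sign turns the exponent into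
    -- minus the reflection of `H`.
    obtain ⟨K, hK1, hK2⟩ := exists_herglotz_kernel g hz1 1
    have h1 : ∀ θ : ℝ, (Real.log (w (Circle.exp θ)) : ℂ) *
        (((Circle.exp θ : ℂ) + z) / ((Circle.exp θ : ℂ) - z))
          = -(g * K) (Circle.exp θ) := fun θ => by
      rw [ContinuousMap.mul_apply, hK1]
      change _ = -((Real.log (w (Circle.exp θ)) : ℂ) * _)
      rw [← mul_neg, ← div_neg, zpow_one, ← mul_div_mul_left _ (-(1 - _)) hz0]
      congr 2 <;> field_simp <;> ring
    rw [szego]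
    simp only [h1, intervalIntegral.integral_neg]
    congr 1
    have h2 : (1 / (4 * π) : ℂ) * -∫ θ in (0 : ℝ)..(2 * π), (g * K) (Circle.exp θ)
        = -(mean (g * K) / 2) := by
      rw [mean_apply]
      ring
    have h3 : starRingEnd ℂ (∑' n : ℕ, coef g n * (starRingEnd ℂ z⁻¹) ^ n)
        = ∑' n : ℕ, z⁻¹ ^ n * coef g (-(1 * n)) := by
      rw [Complex.conj_tsum]
      refine tsum_congr fun n => ?_
      rw [one_mul, hneg, map_mul, map_pow, Complex.conj_conj, mul_comm]
    rw [h2, hK2]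
    simp only [H, map_sub, map_div₀, hreal, h3, Complex.conj_ofNat]
    ring
  · have h1 : H 0 = coef g 0 / 2 := by
      have h2 : ∑' n : ℕ, coef g n * (0 : ℂ) ^ n = coef g 0 := by
        rw [tsum_eq_single 0 fun n hn => by rw [zero_pow hn, mul_zero]]
        simp
      simp only [H, h2]
      ring
    have h3 : coef g 0 / 2
        = ((1 / (4 * π) * ∫ θ in (0 : ℝ)..(2 * π), Real.log (w (Circle.exp θ)) : ℝ) : ℂ) := by
      rw [coef_zero_index, mean_apply]
      push_cast
      rw [← intervalIntegral.integral_ofReal]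
      simp only [g, ContinuousMap.coe_mk]
      ring
    rw [h1, h3, ← Complex.ofReal_exp, tau, ← Real.exp_neg]
    congr 2
    ring

/-! ### The constant `ρ` and the outer pair of the weight -/

lemma rho_nonneg (w : Circle → ℝ) : 0 ≤ rho w :=
  Real.sInf_nonneg fun _ hs => hs.1.le

lemma IsPositiveAnalyticWeight.extends_inv (hw : IsPositiveAnalyticWeight w) :
    {s : ℝ | 0 < s ∧ s < 1 ∧ ExtendsToAnnulus (fun z => 1 / (w z : ℂ)) s}.Nonempty := by
  obtain ⟨t, ht0, ht1, L, hL, hLw⟩ := hw.exists_log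
  refine ⟨t, ht0, ht1, fun z => Complex.exp (-L z), hL.neg.cexp, fun z => ?_⟩
  change Complex.exp (-L z) = 1 / (w z : ℂ)
  rw [hLw, Complex.exp_neg, ← Complex.ofReal_exp, Real.exp_log (hw.1 z), one_div]

lemma IsPositiveAnalyticWeight.rho_lt_one (hw : IsPositiveAnalyticWeight w) : rho w < 1 := by
  obtain ⟨s, hs⟩ := hw.extends_inv
  exact (csInf_le ⟨0, fun _ h => h.1.le⟩ hs).trans_lt hs.2.1

lemma extendFrom_eq_of_eqOn_inside {F G : ℂ → ℂ} {u : Circle} (hF : ContinuousAt F u)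
    (h : ∀ z, ‖z‖ < 1 → G z = F z) : extendFrom {z : ℂ | ‖z‖ < 1} G u = F u := by
  refine extendFrom_eq ?_ ((hF.tendsto.mono_left nhdsWithin_le_nhds).congr' ?_)
  · have h1 : {z : ℂ | ‖z‖ < 1} = Metric.ball 0 1 := by
      ext z
      simp
    rw [h1, closure_ball _ one_ne_zero, mem_closedBall_zero_iff, Circle.norm_coe]
  · filter_upwards [self_mem_nhdsWithin] with z hz
    exact (h z hz).symm

lemma extendFrom_eq_of_eqOn_outside {F G : ℂ → ℂ} {u : Circle} (hF : ContinuousAt F u)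
    (h : ∀ z, 1 < ‖z‖ → G z = F z) : extendFrom {z : ℂ | 1 < ‖z‖} G u = F u := by
  refine extendFrom_eq ?_ ((hF.tendsto.mono_left nhdsWithin_le_nhds).congr' ?_)
  · have h1 : Continuous fun x : ℝ => (x : ℂ) * u := by fun_prop
    have h2 : (1 : ℝ) ∈ closure (Set.Ioi 1) := by
      rw [closure_Ioi]
      exact Set.self_mem_Ici
    have h3 := map_mem_closure h1 h2 (t := {z : ℂ | 1 < ‖z‖}) fun x hx => by
      rw [Set.mem_Ioi] at hx
      change 1 < ‖(x : ℂ) * u‖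
      rw [norm_mul, Circle.norm_coe, mul_one, Complex.norm_real, Real.norm_of_nonneg (by linarith)]
      exact hx
    simpa using h3
  · filter_upwards [self_mem_nhdsWithin] with z hz
    exact (h z hz).symm

/-- The outer function of the weight `w`, with all its properties that matter for the
asymptotics of the orthonormal polynomials. -/
lemma IsPositiveAnalyticWeight.exists_outerPair (hw : IsPositiveAnalyticWeight w) :
    ∃ D E : C(Circle, ℂ), OuterPair D E ∧ (∀ z, w z = ‖D z‖ ^ 2) ∧ ‖mean D‖ = (tau w)⁻¹ ∧
      (∀ k, scatteringCoeff w k = coef (D * star E) k) ∧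
      IsScatteringLaurent w (coef (D * star E)) ∧
      ∀ r, rho w < r → r < 1 → ∃ C, ∀ k : ℤ, ‖coef E k‖ ≤ C * r ^ k := by
  obtain ⟨t, ht0, ht1, H, hH, hin, hout, hpair, hzero⟩ := hw.exists_exponent
  have hR : 1 < t⁻¹ := (one_lt_inv₀ ht0).2 ht1
  have hmem : ∀ u : Circle, (u : ℂ) ∈ Metric.ball (0 : ℂ) t⁻¹ := fun u => by
    rwa [mem_ball_zero_iff, Circle.norm_coe]
  have hHc : Continuous fun u : Circle => H u :=
    hH.continuousOn.comp_continuous continuous_subtype_val hmem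
  let D : C(Circle, ℂ) := ⟨fun u => Complex.exp (H u), hHc.cexp⟩
  let E : C(Circle, ℂ) := ⟨fun u => Complex.exp (-H u), hHc.neg.cexp⟩
  have hDd : DifferentiableOn ℂ (fun z => Complex.exp (H z)) (Metric.ball 0 t⁻¹) := hH.cexp
  have hEd : DifferentiableOn ℂ (fun z => Complex.exp (-H z)) (Metric.ball 0 t⁻¹) := hH.neg.cexp
  obtain ⟨hD1, hD2, hD3, hD4⟩ := coef_of_differentiableOn_ball hR hDd (g := D) fun _ => rfl
  obtain ⟨hE1, hE2, hE3, hE4⟩ := coef_of_differentiableOn_ball hR hEd (g := E) fun _ => rfl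
  -- the continuation of the reflected exponent
  have hrefl : ∀ z : ℂ, t < ‖z‖ →
      DifferentiableAt ℂ (fun z => starRingEnd ℂ (H (starRingEnd ℂ z⁻¹))) z := fun z hz => by
    have hz0 : z ≠ 0 := norm_pos_iff.1 (ht0.trans hz)
    have h1 : starRingEnd ℂ z⁻¹ ∈ Metric.ball (0 : ℂ) t⁻¹ := by
      rw [mem_ball_zero_iff, RCLike.norm_conj, norm_inv]
      exact (inv_lt_inv₀ (ht0.trans hz) ht0).2 hz
    have h2 := (hH.differentiableAt (Metric.isOpen_ball.mem_nhds h1)).conj_conj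
    rw [Complex.conj_conj] at h2
    exact h2.comp z (differentiableAt_inv hz0)
  have hcircle : ∀ u : Circle, starRingEnd ℂ (u : ℂ)⁻¹ = u := fun u => by
    rw [← Circle.coe_inv, Circle.coe_inv_eq_conj, Complex.conj_conj]
  -- The continuation of the exterior Szegő function to `t < |z|`; on the circle it is `star E`.
  let De : ℂ → ℂ := fun z => Complex.exp (-(starRingEnd ℂ (H (starRingEnd ℂ z⁻¹))))
  have hDe : ∀ z : ℂ, t < ‖z‖ → DifferentiableAt ℂ De z := fun z hz => (hrefl z hz).neg.cexp
  have hDeE : ∀ u : Circle, De u = star E u := fun u => by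
    simp only [De, hcircle]
    change _ = starRingEnd ℂ (Complex.exp (-H u))
    rw [← Complex.exp_conj, map_neg]
  have hDE : D * E = 1 := by
    ext u
    change Complex.exp (H u) * Complex.exp (-H u) = 1
    rw [← Complex.exp_add, add_neg_cancel, Complex.exp_zero]
  have hwD : ∀ z, w z = ‖D z‖ ^ 2 := fun u => by
    have h1 : ((‖D u‖ ^ 2 : ℝ) : ℂ) = w u := by
      push_cast
      rw [← Complex.mul_conj']
      change Complex.exp (H u) * starRingEnd ℂ (Complex.exp (H u)) = _
      rw [← Complex.exp_conj, ← Complex.exp_add, hpair, ← Complex.ofReal_exp,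
        Real.exp_log (hw.1 u)]
    exact_mod_cast h1.symm
  have hscat : ∀ u : Circle, scattering w u = (D * star E) u := fun u => by
    have h1 : szegoInt w u = D u :=
      extendFrom_eq_of_eqOn_inside
        (hDd.differentiableAt (Metric.isOpen_ball.mem_nhds (hmem u))).continuousAt hin
    have h2 : szegoExt w u = De u :=
      extendFrom_eq_of_eqOn_outside (hDe u (by rwa [Circle.norm_coe])).continuousAt hout
    rw [scattering, h1, h2, hDeE, ContinuousMap.mul_apply]
  have hlaurent : ∀ z ∈ annulus t,
      HasSum (fun k : ℤ => coef (D * star E) k * z ^ k) (Complex.exp (H z) * De z) := by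
    rintro z ⟨hz1, hz2⟩
    have hz0 : z ≠ 0 := norm_pos_iff.1 (ht0.trans hz1)
    have h1 := hD4 z hz0 hz2
    have h2 : HasSum (fun k : ℤ => coef (star E) k * z ^ k) (De z) := by
      have h3 := Complex.hasSum_conj'.2 (hE4 (starRingEnd ℂ z⁻¹)
        ((_root_.map_ne_zero _).2 (inv_ne_zero hz0)) (by
          rw [RCLike.norm_conj, norm_inv]
          exact (inv_lt_inv₀ (ht0.trans hz1) ht0).2 hz1))
      rw [← (Equiv.neg ℤ).hasSum_iff] at h3
      have h4 : De z = starRingEnd ℂ (Complex.exp (-H (starRingEnd ℂ z⁻¹))) := by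
        rw [← Complex.exp_conj, map_neg]
      rw [h4]
      refine h3.congr_fun fun k => ?_
      simp [coef_star]
    refine hasSum_conv h1 h2 fun k => ?_
    refine ((hasSum_coef_mul (hasSum_coef hD1) (star E) k).mul_right (z ^ k)).congr_fun fun j => ?_
    rw [mul_mul_mul_comm, ← zpow_add₀ hz0, add_sub_cancel]
  refine ⟨D, E, ⟨hDE, hD1, hE1, hD2, hE2, ?_⟩, hwD, ?_, fun k => ?_, ?_, fun r hr hr1 => ?_⟩
  · have h1 := (hlaurent 1 (by
      rw [← Circle.coe_one]
      exact coe_mem_annulus ht0 ht1 1)).summable.norm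
    simpa using h1
  · have h2 : 0 < tau w := Real.exp_pos _
    rw [← coef_zero_index, hD3, hzero, Complex.norm_real, Real.norm_of_nonneg (by positivity)]
  · rw [scatteringCoeff, coef, mean_apply]
    congr 2
    ext θ
    simp only [hscat, ContinuousMap.mul_apply, zpowMap_apply]
  · refine ⟨t, ht0, ht1, fun z => Complex.exp (H z), De, ?_, fun z hz => (hin z hz).symm, ?_,
      fun z hz => (hout z hz).symm, hlaurent⟩
    · exact hDd.mono fun z hz => mem_ball_zero_iff.2 hz
    · exact fun z hz => (hDe z hz).differentiableWithinAt
  · obtain ⟨s, ⟨hs0, hs1, f, hf, hfw⟩, hsr⟩ := exists_lt_of_csInf_lt hw.extends_inv hr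
    -- On the circle this is `conj D / w = E`. The reflected factor is holomorphic on all of `t <
    -- |z|`, so the outer radius `s⁻¹` is that of `1 / w`, while `t` affects only the inner one.
    let F : ℂ → ℂ := fun z => f z * Complex.exp (starRingEnd ℂ (H (starRingEnd ℂ z⁻¹)))
    refine exists_norm_coef_le (f := F) (g := E) (t := max s t) (max_lt hs1 ht1) hs0 hsr hr1 ?_ ?_
    · intro z hz
      have h1 : s < ‖z‖ := (le_max_left _ _).trans_lt hz.1
      have h2 : t < ‖z‖ := (le_max_right _ _).trans_lt hz.1
      exact ((hf.differentiableAt ((isOpen_annulus s).mem_nhds ⟨h1, hz.2⟩)).mul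
        (hrefl z h2).cexp).differentiableWithinAt
    · intro u
      have h1 : f u = 1 / (w u : ℂ) := hfw u
      have h2 : (w u : ℂ) = Complex.exp (H u) * Complex.exp (starRingEnd ℂ (H u)) := by
        rw [← Complex.exp_add, hpair, ← Complex.ofReal_exp, Real.exp_log (hw.1 u)]
      simp only [F, hcircle, h1, h2]
      change _ = Complex.exp (-H u)
      rw [Complex.exp_neg]
      field_simp

end OPUC

/-! ### The asymptotics of the leading coefficients -/

theorem mainTheorem7 (w : Circle → ℝ) (hw : OPUC.IsPositiveAnalyticWeight w) :
    OPUC.IsScatteringLaurent w (OPUC.scatteringCoeff w) ∧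
    Summable (fun k : ℤ => ‖OPUC.scatteringCoeff w k‖ ^ 2) ∧
    (∃ φ : ℕ → ℂ[X], OPUC.IsOrthonormalPolynomials w φ) ∧
    ∀ φ : ℕ → ℂ[X], OPUC.IsOrthonormalPolynomials w φ →
      (∀ r : ℝ, OPUC.rho w < r → r < 1 →
        (fun n : ℕ => OPUC.kappa φ n ^ 2 - OPUC.tau w ^ 2 / (2 * π) *
            ∑' k : Set.Ioi (-(n : ℤ) - 1), ‖OPUC.scatteringCoeff w k‖ ^ 2)
          =O[atTop] (fun n : ℕ => r ^ (4 * n)) ∧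
        (fun n : ℕ => OPUC.kappa φ n ^ 2 - OPUC.tau w ^ 2 / (2 * π) *
            (1 - ∑' k : Set.Iic (-(n : ℤ) - 1), ‖OPUC.scatteringCoeff w k‖ ^ 2))
          =O[atTop] (fun n : ℕ => r ^ (4 * n))) ∧
      Tendsto (fun n : ℕ => OPUC.kappa φ n ^ 2) atTop (𝓝 (OPUC.tau w ^ 2 / (2 * π))) := by
  obtain ⟨D, E, h, hwD, hτ, hcoef, hlaurent, hbound⟩ := hw.exists_outerPair
  rw [show OPUC.scatteringCoeff w = OPUC.coef (D * star E) from funext hcoef]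
  have hτ0 : 0 < OPUC.tau w := Real.exp_pos _
  refine ⟨hlaurent, h.hasSum_norm_coef_sq_scattering.summable,
    OPUC.exists_orthonormal_polynomials hwD fun z hz => ?_, fun φ hφ => ?_⟩
  · have h1 := hw.1 z
    rw [hwD, hz] at h1
    simp at h1
  have hhigh : ∀ n : ℕ, ∑' k : Set.Ioi (-(n : ℤ) - 1), ‖OPUC.coef (D * star E) k‖ ^ 2
      = OPUC.meanSq (OPUC.OuterPair.highPart D E n) := fun n => by
    rw [tsum_subtype (Set.Ioi (-(n : ℤ) - 1)) fun k => ‖OPUC.coef (D * star E) k‖ ^ 2,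
      ← (h.hasSum_meanSq_highPart n).tsum_eq]
    refine tsum_congr fun k => ?_
    by_cases hk : k ≤ -(n : ℤ) - 1
    · rw [if_pos hk, Set.indicator_of_notMem (by simpa using hk)]
    · rw [if_neg hk, Set.indicator_of_mem (by simpa using hk)]
  have hlow : ∀ n : ℕ, 1 - ∑' k : Set.Iic (-(n : ℤ) - 1), ‖OPUC.coef (D * star E) k‖ ^ 2
      = OPUC.meanSq (OPUC.OuterPair.highPart D E n) := fun n => by
    rw [h.meanSq_highPart, ← (h.hasSum_meanSq_lowPart n).tsum_eq,
      tsum_subtype (Set.Iic (-(n : ℤ) - 1)) fun k => ‖OPUC.coef (D * star E) k‖ ^ 2]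
    congr 1
    refine tsum_congr fun k => ?_
    by_cases hk : k ≤ -(n : ℤ) - 1
    · rw [if_pos hk, Set.indicator_of_mem (by simpa using hk)]
    · rw [if_neg hk, Set.indicator_of_notMem (by simpa using hk)]
  have hmain : ∀ r : ℝ, OPUC.rho w < r → r < 1 →
      (fun n : ℕ => OPUC.kappa φ n ^ 2 - OPUC.tau w ^ 2 / (2 * π) *
        OPUC.meanSq (OPUC.OuterPair.highPart D E n)) =O[atTop] fun n : ℕ => r ^ (4 * n) := by
    intro r hr hr1
    obtain ⟨C, hC⟩ := hbound r hr hr1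
    have h1 := h.extremal_isBigO ((OPUC.rho_nonneg w).trans_lt hr) hr1 hC
      (x := fun n => 2 * π * ‖OPUC.mean D‖ ^ 2 * OPUC.kappa φ n ^ 2)
      (OPUC.kappa_sq_le h hwD hφ) (OPUC.le_kappa_sq h hwD hφ)
    -- `‖mean D‖ = τ⁻¹`, so this factor turns the extremal value back into `κ_n²`.
    refine (h1.const_mul_left (OPUC.tau w ^ 2 / (2 * π))).congr_left fun n => ?_
    rw [hτ]
    field_simp
  refine ⟨fun r hr hr1 => ?_, ?_⟩
  · simp only [hhigh, hlow]
    exact ⟨hmain r hr hr1, hmain r hr hr1⟩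
  · obtain ⟨r, hr, hr1⟩ := exists_between hw.rho_lt_one
    have hr0 := (OPUC.rho_nonneg w).trans_lt hr
    obtain ⟨C, hC⟩ := hbound r hr hr1
    have h1 := (h.tendsto_meanSq_highPart hr0 hr1 hC).const_mul (OPUC.tau w ^ 2 / (2 * π))
    have h2 : Tendsto (fun n : ℕ => r ^ (4 * n)) atTop (𝓝 0) := by
      simpa only [pow_mul] using
        tendsto_pow_atTop_nhds_zero_of_lt_one (by positivity) (pow_lt_one₀ hr0.le hr1 four_ne_zero)
    have h3 := ((hmain r hr hr1).trans_tendsto h2).add h1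
    simpa using h3
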